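/- \textbf{Model.} There are $4$ bins. Every ball $x$ (from an infinite universe of balls) has a hash $h(x)=(h_1(x),h_2(x))$; the hashes are independent and uniformly distributed over the $12$ ordered pairs of distinct bins, and the hash of a ball never changes. In the reinsertion/deletion model with capacity $m$, the system is initially empty and an oblivious adversary fixes a finite sequence of operations in advance, without knowledge of the hashes or of the random choices of the insertion strategy. Each operation is $\textsc{Insert}(x)$, where $x$ is not currently present (but may have been present before), or $\textsc{Delete}(x)$, where $x$ is currently present; at most $m$ balls may be present at any time. Whenever $x$ is inserted, the insertion strategy places it in bin $h_1(x)$ or in bin $h_2(x)$, where it stays until it is deleted. The (possibly randomized) strategy is \emph{ID-oblivious}: it sees an insertion of $x$ only as the pair $(h_1(x),h_2(x))$, and a deletion only as the number $r$ such that the $r$-th most recently inserted ball of those present is deleted; each of its decisions depends only on what it has seen so far, on the pair of the ball being inserted, and on its own random bits, which are independent of the hashes. The load of a bin is the number of balls currently in it. \textbf{Theorem.} There are a constant $\varepsilon>0$ and a constant $d\in\mathbb{N}$ such that for every $c>0$ there is an $m_0$ such that the following holds for all $m\ge m_0$. For every ID-oblivious insertion strategy, there is an oblivious sequence of at most $m^{d}$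 operations, with never more than $m$ balls present, such that with probability at least $1-m^{-c}$ (over the hashes and the random bits of the strategy), at some point during the sequence some bin has load at least $m/4+m^{\varepsilon}$. -/

import Mathlib

open MeasureTheory

namespace BallsBins

/-- The hash of a ball: an ordered pair of distinct bins among the four bins. -/
abbrev BinPair : Type := {p : Fin 4 × Fin 4 // p.1 ≠ p.2}

instance instNonemptyBinPair : Nonempty BinPair := ⟨⟨(0, 1), by decide⟩⟩

/-- An operation of the adversary. Balls are identified by natural numbers. A ball that was
deleted earlier may be inserted again. -/
inductive Op : Type
  | insert (x : ℕ) : Op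
  | delete (x : ℕ) : Op

/-- `Legal m P ops`: starting with the set `P` of balls present, every insertion in `ops` concerns
a ball that is currently absent, every deletion concerns a ball that is currently present, and no
insertion brings the number of balls present above `m`. -/
def Legal (m : ℕ) : Finset ℕ → List Op → Prop
  | _, [] => True
  | P, Op.insert x :: ops => x ∉ P ∧ P.card + 1 ≤ m ∧ Legal m (insert x P) ops
  | P, Op.delete x :: ops => x ∈ P ∧ Legal m (P.erase x) ops

/-- What an ID-oblivious insertion strategy gets to see of an operation: the hash of an inserted
ball, or, for a deletion, the number `r` such that the `r`-th most recently inserted ball of those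
present is deleted. -/
inductive Request : Type
  | insert (p : BinPair) : Request
  | delete (r : ℕ) : Request

/-- A (deterministic) ID-oblivious insertion strategy: given the earlier requests, most recent
first, and the hash of the ball being inserted, choose the first bin of the hash (`true`) or the
second one (`false`). The strategy's own earlier decisions are functions of the earlier requests.
A randomized strategy is a random element of this type. -/
abbrev Strategy : Type := List Request → BinPair → Bool

/-- The state of the system. -/
structure State : Type where
  /-- the balls present, each with the bin in which it resides, most recently inserted first -/
  present : List (ℕ × Fin 4)
  /-- the requests made so far, most recent first -/
  history : List Request

/-- The bin into which strategy `S` puts a ball with hash `p` after the requests `hist`. -/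
def chosenBin (S : Strategy) (hist : List Request) (p : BinPair) : Fin 4 :=
  if S hist p then p.1.1 else p.1.2

/-- One operation, when the balls have hashes `h` and insertions follow strategy `S`. -/
def step (S : Strategy) (h : ℕ → BinPair) (s : State) : Op → State
  | Op.insert x =>
      { present := (x, chosenBin S s.history (h x)) :: s.present
        history := Request.insert (h x) :: s.history }
  | Op.delete x =>
      { present := s.present.filter (fun y => decide (y.1 ≠ x))
        history := Request.delete ((s.present.map Prod.fst).idxOf x + 1) :: s.history }

/-- The state after a sequence of operations, starting with an empty system. -/
def run (S : Strategy) (h : ℕ → BinPair) (ops : List Op) : State :=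
  ops.foldl (step S h) { present := [], history := [] }

/-- The load of bin `b`: the number of balls that reside in it. -/
def load (s : State) (b : Fin 4) : ℕ :=
  s.present.countP (fun y => decide (y.2 = b))

/-- At some point during the sequence `ops`, some bin has load at least `L`. -/
def ReachesLoad (S : Strategy) (h : ℕ → BinPair) (ops : List Op) (L : ℝ) : Prop :=
  ∃ t ≤ ops.length, ∃ b : Fin 4, L ≤ (load (run S h (ops.take t)) b : ℝ)

/-- The law of the hash function: the hashes of the balls are independent and uniformly
distributed over the ordered pairs of distinct bins. -/
noncomputable def hashMeasure : Measure (ℕ → BinPair) :=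
  Measure.infinitePi (fun _ : ℕ => (PMF.uniformOfFintype BinPair).toMeasure)

end BallsBins

/-!
The bins are split into the halves `{0, 1}` and `{2, 3}`; the imbalance of a set of balls is the
number of those in the first half minus the number of those in the second (`imb`). While the system
is full and not overloaded, the total imbalance is at most `4 * m ^ ε`. The adversary reserves a set
`X` of `k = 12 s ^ 2` balls, with `s` about `m ^ (1 / 10)`, and bets that `X` has exactly
`s ^ 2 + 4 s` balls of each of the two hashes confined to the first half, `s ^ 2 - 4 s` of each of
those confined to the second, and `s ^ 2` of each other hash. The bet is won with probability
polynomial in `1 / m` (`surplus_prob`); everything below is conditional on it.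

The key step (`sum_orders_ge`) concerns the insertion of `X` together with a fresh block `Q` of `k`
balls in random order. The strategy cannot distinguish balls with the same hash, so that the mean
side of a ball depends on its hash only. The hashes that leave the strategy a choice are almost
equally frequent in `X` and in `Q`, up to the fluctuations of order `s` of the hashes of `Q`; hence
the mean imbalance of `X` exceeds that of `Q` by a fixed multiple of `s`, for every strategy.

The balls present form blocks of `k` balls. Two blocks with similar mean imbalances are deleted, `X`
and `Q` are inserted, and then `X` is replaced by a further fresh block, which balance forces to
have the mean imbalance that `X` had (`Arena.replace`). So the two means are pushed apart, as in a
chip-firing game, and the sum of the squares of the means (`potential`) grows by at least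
`4 s ^ 2`, except for an error caused by the drift of the total imbalance. If the replacements are
performed in batches within a narrow window of means, which the pigeonhole principle provides, the
errors telescope, because the total imbalance is bounded at all times (`Arena.batch`). As a block of
`k` balls has imbalance at most `k`, the potential is bounded. Thus after polynomially many batches
balance must have failed with probability at least `1 / m` (`Arena.exists_overload`).

Since `X` can be reinserted as often as desired, a single bet suffices for all replacements of a
round. Rounds are repeated with fresh balls, conditionally on the failure of the earlier ones
(`exists_round`), which reduces the probability of failure below `m ^ (-c)`.
-/

namespace BallsBins

/-! ### Legality and the balls present -/

/-- The set of balls present after the operations `ops`, when the balls in `P` are present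
initially. -/
def curr : Finset ℕ → List Op → Finset ℕ
  | P, [] => P
  | P, Op.insert x :: ops => curr (insert x P) ops
  | P, Op.delete x :: ops => curr (P.erase x) ops

/-- The ball that an operation concerns. -/
def Op.ball : Op → ℕ
  | Op.insert x => x
  | Op.delete x => x

theorem curr_append (P : Finset ℕ) (a b : List Op) :
    curr P (a ++ b) = curr (curr P a) b := by
  induction a generalizing P with
  | nil => rfl
  | cons o a ih => cases o <;> simp [curr, ih]

theorem legal_append (m : ℕ) (P : Finset ℕ) (a b : List Op) :
    Legal m P (a ++ b) ↔ Legal m P a ∧ Legal m (curr P a) b := by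
  induction a generalizing P with
  | nil => simp [Legal, curr]
  | cons o a ih => cases o <;> simp [Legal, curr, ih, and_assoc]

theorem curr_inserts (P : Finset ℕ) (l : List ℕ) :
    curr P (l.map Op.insert) = P ∪ l.toFinset := by
  induction l generalizing P with
  | nil => simp [curr]
  | cons x l ih => simp [curr, ih]

theorem legal_inserts (m : ℕ) (P : Finset ℕ) (l : List ℕ) (hl : l.Nodup)
    (hP : ∀ x ∈ l, x ∉ P) (hc : P.card + l.length ≤ m) : Legal m P (l.map Op.insert) := by
  induction l generalizing P with
  | nil => simp [Legal]
  | cons x l ih =>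
    have hx : x ∉ P := hP x (by simp)
    simp only [List.length_cons] at hc
    rw [List.nodup_cons] at hl
    refine ⟨hx, by omega, ih _ hl.2 ?_ ?_⟩
    · intro y hy
      simp only [Finset.mem_insert, not_or]
      exact ⟨fun h => hl.1 (h ▸ hy), hP y (by simp [hy])⟩
    · rw [Finset.card_insert_of_notMem hx]; omega

theorem curr_deletes (P : Finset ℕ) (l : List ℕ) :
    curr P (l.map Op.delete) = P \ l.toFinset := by
  induction l generalizing P with
  | nil => simp [curr]
  | cons x l ih =>
    simp only [List.map_cons, curr, ih, List.toFinset_cons]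
    ext y; simp only [Finset.mem_sdiff, Finset.mem_erase, Finset.mem_insert]; tauto

theorem legal_deletes (m : ℕ) (P : Finset ℕ) (l : List ℕ) (hl : l.Nodup)
    (hP : ∀ x ∈ l, x ∈ P) : Legal m P (l.map Op.delete) := by
  induction l generalizing P with
  | nil => simp [Legal]
  | cons x l ih =>
    rw [List.nodup_cons] at hl
    refine ⟨hP x (by simp), ih _ hl.2 ?_⟩
    intro y hy
    exact Finset.mem_erase.2 ⟨fun h => hl.1 (h ▸ hy), hP y (by simp [hy])⟩

/-- The balls listed in the state `s` are exactly those of `P`, each listed once. -/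
def Tracks (s : State) (P : Finset ℕ) : Prop :=
  (s.present.map Prod.fst).Nodup ∧ ∀ x, x ∈ s.present.map Prod.fst ↔ x ∈ P

theorem Tracks.foldl {S : Strategy} {h : ℕ → BinPair} {m : ℕ} {s : State} {P : Finset ℕ}
    {ops : List Op} (hs : Tracks s P) (hl : Legal m P ops) :
    Tracks (ops.foldl (step S h) s) (curr P ops) := by
  induction ops generalizing s P with
  | nil => exact hs
  | cons o ops ih =>
    cases o with
    | insert x =>
      refine ih (s := step S h s (Op.insert x)) ?_ hl.2.2
      refine ⟨?_, fun y => ?_⟩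
      · simp only [step, List.map_cons, List.nodup_cons]
        exact ⟨fun hx => hl.1 ((hs.2 x).1 hx), hs.1⟩
      · simp only [step, List.map_cons, List.mem_cons, Finset.mem_insert]
        rw [hs.2 y]
    | delete x =>
      refine ih (s := step S h s (Op.delete x)) ?_ hl.2
      have hf : ((s.present.filter (fun y => decide (y.1 ≠ x))).map Prod.fst)
          = (s.present.map Prod.fst).filter (fun y => decide (y ≠ x)) := by
        rw [List.filter_map]; rfl
      refine ⟨?_, fun y => ?_⟩
      · simp only [step]
        rw [hf]; exact hs.1.filter _
      · simp only [step]
        rw [hf, List.mem_filter, hs.2 y, Finset.mem_erase]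
        simp [and_comm]

theorem tracks_run {S : Strategy} {h : ℕ → BinPair} {m : ℕ} {ops : List Op}
    (hl : Legal m ∅ ops) : Tracks (run S h ops) (curr ∅ ops) :=
  Tracks.foldl (s := ⟨[], []⟩) ⟨by simp, by simp⟩ hl

theorem run_append (S : Strategy) (h : ℕ → BinPair) (a b : List Op) :
    run S h (a ++ b) = b.foldl (step S h) (run S h a) := by
  simp [run, List.foldl_append]

theorem ReachesLoad.append {S : Strategy} {h : ℕ → BinPair} {a : List Op} {L : ℝ}
    (H : ReachesLoad S h a L) (b : List Op) : ReachesLoad S h (a ++ b) L := by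
  obtain ⟨t, ht, c, hc⟩ := H
  refine ⟨t, by rw [List.length_append]; omega, c, ?_⟩
  rwa [List.take_append_of_le_length ht]

/-! ### The imbalance between the bins `0, 1` and the bins `2, 3` -/

/-- The sign of a bin: `1` for the bins `0` and `1`, and `-1` for the bins `2` and `3`. -/
def side (b : Fin 4) : ℝ := if b = 0 ∨ b = 1 then 1 else -1

/-- The number of balls of `A` that reside in bins `0, 1`, minus the number of those that reside
in bins `2, 3`. -/
noncomputable def imb (A : Finset ℕ) (s : State) : ℝ :=
  (s.present.map (fun y => if y.1 ∈ A then side y.2 else 0)).sum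

theorem abs_side (b : Fin 4) : |side b| = 1 := by
  unfold side; split_ifs <;> simp

theorem imb_eq_sum (A : Finset ℕ) (s : State) : imb A s = ∑ a ∈ A, imb {a} s := by
  unfold imb
  induction s.present with
  | nil => simp
  | cons y L ih =>
    simp only [List.map_cons, List.sum_cons, Finset.sum_add_distrib, ih, Finset.mem_singleton]
    congr 1
    rw [Finset.sum_ite_eq A y.1]

theorem imb_union {A B : Finset ℕ} (hAB : Disjoint A B) (s : State) :
    imb (A ∪ B) s = imb A s + imb B s := by
  rw [imb_eq_sum, imb_eq_sum A, imb_eq_sum B, Finset.sum_union hAB]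

theorem imb_step_of_ne {S : Strategy} {h : ℕ → BinPair} {s : State} {A : Finset ℕ} {o : Op}
    (ho : o.ball ∉ A) : imb A (step S h s o) = imb A s := by
  cases o with
  | insert x => simp only [Op.ball] at ho; simp [imb, step, ho]
  | delete x =>
    simp only [Op.ball] at ho
    unfold imb
    simp only [step]
    induction s.present with
    | nil => simp
    | cons y L ih =>
      by_cases hy : y.1 = x
      · have : y.1 ∉ A := hy ▸ ho
        rw [List.filter_cons_of_neg (by simpa using hy)]
        simp only [List.map_cons, List.sum_cons, if_neg this, zero_add, ih]
      · rw [List.filter_cons_of_pos (by simpa using hy)]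
        simp only [List.map_cons, List.sum_cons, ih]

theorem imb_foldl_of_ne {S : Strategy} {h : ℕ → BinPair} {s : State} {A : Finset ℕ}
    {ops : List Op} (ho : ∀ o ∈ ops, o.ball ∉ A) :
    imb A (ops.foldl (step S h) s) = imb A s := by
  induction ops generalizing s with
  | nil => rfl
  | cons o ops ih =>
    rw [List.foldl_cons, ih (fun o' h' => ho o' (by simp [h'])), imb_step_of_ne (ho o (by simp))]

theorem imb_run_append_of_ne {S : Strategy} {h : ℕ → BinPair} {A : Finset ℕ}
    (pre : List Op) {ops : List Op} (ho : ∀ o ∈ ops, o.ball ∉ A) :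
    imb A (run S h (pre ++ ops)) = imb A (run S h pre) := by
  rw [run_append, imb_foldl_of_ne ho]

theorem imb_eq_zero {s : State} {A P : Finset ℕ} (hs : Tracks s P) (hA : Disjoint A P) :
    imb A s = 0 := by
  unfold imb
  apply List.sum_eq_zero
  intro r hr
  obtain ⟨y, hy, rfl⟩ := List.mem_map.1 hr
  have : y.1 ∈ P := (hs.2 y.1).1 (List.mem_map_of_mem hy)
  rw [if_neg (fun h => Finset.disjoint_left.1 hA h this)]

theorem abs_imb_le {s : State} {P : Finset ℕ} (hs : Tracks s P) (A : Finset ℕ) :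
    |imb A s| ≤ A.card := by
  have h1 : |imb A s| ≤ (((s.present.map Prod.fst).filter (fun x => x ∈ A)).length : ℝ) := by
    unfold imb
    induction s.present with
    | nil => simp
    | cons y L ih =>
      simp only [List.map_cons, List.sum_cons]
      refine (abs_add_le _ _).trans ?_
      by_cases hy : y.1 ∈ A
      · rw [List.filter_cons_of_pos (by simpa using hy), if_pos hy, abs_side, List.length_cons]
        push_cast; linarith
      · rw [List.filter_cons_of_neg (by simpa using hy), if_neg hy]
        simpa using ih
  refine h1.trans ?_
  norm_cast
  rw [← List.toFinset_card_of_nodup (hs.1.filter _)]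
  apply Finset.card_le_card
  intro x hx
  simpa using (List.mem_filter.1 (List.mem_toFinset.1 hx)).2

theorem imb_all_eq_loads {s : State} {P : Finset ℕ} (hs : Tracks s P) :
    imb P s = (load s 0 + load s 1 : ℝ) - (load s 2 + load s 3) ∧
      (P.card : ℝ) = load s 0 + load s 1 + (load s 2 + load s 3) := by
  have hc : P.card = s.present.length := by
    rw [← List.length_map (f := Prod.fst), ← List.toFinset_card_of_nodup hs.1]
    congr 1; ext x; rw [List.mem_toFinset, hs.2]
  have h1 : imb P s = (s.present.map (fun y => side y.2)).sum := by
    unfold imb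
    congr 1
    apply List.map_congr_left
    intro y hy
    rw [if_pos ((hs.2 y.1).1 (List.mem_map_of_mem hy))]
  rw [h1, hc]
  unfold load
  clear h1 hc hs
  induction s.present with
  | nil => simp
  | cons y L ih =>
    obtain ⟨x, b⟩ := y
    simp only [List.map_cons, List.sum_cons, List.length_cons, List.countP_cons]
    obtain ⟨i1, i2⟩ := ih
    rw [i1]
    push_cast
    rw [i2]
    fin_cases b <;> simp [side] <;> constructor <;> ring

theorem abs_imb_all_le {s : State} {P : Finset ℕ} (hs : Tracks s P) {δ : ℝ}
    (hl : ∀ b, (load s b : ℝ) < P.card / 4 + δ) : |imb P s| ≤ 4 * δ := by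
  obtain ⟨h1, h2⟩ := imb_all_eq_loads hs
  rw [h1, abs_le]
  constructor <;> linarith [hl 0, hl 1, hl 2, hl 3]

theorem abs_imb_run_le {S : Strategy} {h : ℕ → BinPair} {m : ℕ} {ops : List Op} {δ : ℝ}
    (hl : Legal m ∅ ops) (hc : (curr ∅ ops).card = m)
    (hn : ¬ ReachesLoad S h ops ((m : ℝ) / 4 + δ)) :
    |imb (curr ∅ ops) (run S h ops)| ≤ 4 * δ := by
  apply abs_imb_all_le (tracks_run hl)
  intro b
  by_contra hb
  push Not at hb
  refine hn ⟨ops.length, le_rfl, b, ?_⟩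
  rw [List.take_length, ← hc]
  exact hb

/-! ### Insertion in random order -/

theorem imb_insert_singleton (S : Strategy) (h : ℕ → BinPair) (s : State) (a x : ℕ) :
    imb {a} (step S h s (Op.insert x)) =
      (if x = a then side (chosenBin S s.history (h x)) else 0) + imb {a} s := by
  simp [imb, step]

/-- The strategy cannot tell two balls with the same hash apart: interchanging them in a sequence
of insertions interchanges their bins. -/
theorem imb_swap {S : Strategy} {h : ℕ → BinPair} {a b : ℕ} (hab : h a = h b)
    (l : List ℕ) {s s' : State} (hist : s.history = s'.history) (hi : imb {b} s' = imb {a} s) :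
    imb {b} (((l.map (Equiv.swap a b)).map Op.insert).foldl (step S h) s') =
      imb {a} ((l.map Op.insert).foldl (step S h) s) := by
  induction l generalizing s s' with
  | nil => exact hi
  | cons x l ih =>
    have hx : h (Equiv.swap a b x) = h x := by
      by_cases h1 : x = a
      · rw [h1, Equiv.swap_apply_left, hab]
      · by_cases h2 : x = b
        · rw [h2, Equiv.swap_apply_right, hab]
        · rw [Equiv.swap_apply_of_ne_of_ne h1 h2]
    simp only [List.map_cons, List.foldl_cons]
    apply ih
    · simp only [step, hist, hx]
    · rw [imb_insert_singleton, imb_insert_singleton, hi, hx, hist]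
      have : Equiv.swap a b x = b ↔ x = a := by
        rw [Equiv.swap_apply_eq_iff, Equiv.swap_apply_right]
      simp only [this]

/-- All orders in which the balls of `W` can be inserted. -/
noncomputable def orders (W : Finset ℕ) : Finset (List ℕ) := W.toList.permutations.toFinset

theorem mem_orders {W : Finset ℕ} {l : List ℕ} : l ∈ orders W ↔ l.Perm W.toList := by
  simp [orders]

theorem orders_nonempty (W : Finset ℕ) : (orders W).Nonempty :=
  ⟨W.toList, mem_orders.2 (List.Perm.refl _)⟩

theorem orders_nodup {W : Finset ℕ} {l : List ℕ} (hl : l ∈ orders W) : l.Nodup :=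
  (mem_orders.1 hl).nodup_iff.2 W.nodup_toList

theorem mem_of_mem_orders {W : Finset ℕ} {l : List ℕ} (hl : l ∈ orders W) (x : ℕ) :
    x ∈ l ↔ x ∈ W := by
  rw [(mem_orders.1 hl).mem_iff, Finset.mem_toList]

theorem length_of_mem_orders {W : Finset ℕ} {l : List ℕ} (hl : l ∈ orders W) :
    l.length = W.card := by
  rw [(mem_orders.1 hl).length_eq, Finset.length_toList]

theorem map_swap_mem_orders {W : Finset ℕ} {l : List ℕ} {a b : ℕ} (ha : a ∈ W) (hb : b ∈ W)
    (hl : l ∈ orders W) : l.map (Equiv.swap a b) ∈ orders W := by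
  rw [mem_orders]
  refine (List.perm_ext_iff_of_nodup ((orders_nodup hl).map (Equiv.injective _))
    W.nodup_toList).2 fun x => ?_
  rw [List.mem_map, Finset.mem_toList]
  constructor
  · rintro ⟨y, hy, rfl⟩
    have := (mem_of_mem_orders hl y).1 hy
    rw [Equiv.swap_apply_def]
    split_ifs <;> assumption
  · intro hx
    refine ⟨Equiv.swap a b x, (mem_of_mem_orders hl _).2 ?_, Equiv.swap_apply_self a b x⟩
    rw [Equiv.swap_apply_def]
    split_ifs <;> assumption

/-- The imbalance of `A` after the insertion of the balls of `l` in state `s`. -/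
noncomputable def imbAfter (S : Strategy) (h : ℕ → BinPair) (s : State) (A : Finset ℕ)
    (l : List ℕ) : ℝ :=
  imb A ((l.map Op.insert).foldl (step S h) s)

theorem sum_orders_eq {S : Strategy} {h : ℕ → BinPair} {s : State} {W : Finset ℕ} {a b : ℕ}
    (ha : a ∈ W) (hb : b ∈ W) (hab : h a = h b) (hi : imb {b} s = imb {a} s) :
    ∑ l ∈ orders W, imbAfter S h s {a} l = ∑ l ∈ orders W, imbAfter S h s {b} l := by
  refine Finset.sum_nbij' (fun l => l.map (Equiv.swap a b)) (fun l => l.map (Equiv.swap a b))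
    (fun l hl => map_swap_mem_orders ha hb hl) (fun l hl => map_swap_mem_orders ha hb hl)
    (fun l _ => ?_) (fun l _ => ?_) (fun l _ => ?_)
  · simp [List.map_map, Function.comp_def]
  · simp [List.map_map, Function.comp_def]
  · exact (imb_swap hab l rfl hi).symm

theorem imbAfter_singleton {S : Strategy} {h : ℕ → BinPair} {s : State} {a : ℕ} {l : List ℕ}
    (hl : l.Nodup) (ha : a ∈ l) :
    ∃ b, (b = (h a).1.1 ∨ b = (h a).1.2) ∧ imbAfter S h s {a} l = side b + imb {a} s := by
  unfold imbAfter
  induction l generalizing s with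
  | nil => simp at ha
  | cons x l ih =>
    rw [List.nodup_cons] at hl
    simp only [List.map_cons, List.foldl_cons]
    by_cases hx : x = a
    · subst hx
      refine ⟨chosenBin S s.history (h x), ?_, ?_⟩
      · unfold chosenBin; split_ifs <;> simp
      · rw [imb_foldl_of_ne, imb_insert_singleton, if_pos rfl]
        intro o ho
        obtain ⟨y, hy, rfl⟩ := List.mem_map.1 ho
        simp only [Op.ball, Finset.mem_singleton]
        rintro rfl
        exact hl.1 hy
    · have ha' : a ∈ l := by
        rcases List.mem_cons.1 ha with h | h
        · exact absurd h.symm hx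
        · exact h
      obtain ⟨b, hb, e⟩ := ih (s := step S h s (Op.insert x)) hl.2 ha'
      refine ⟨b, hb, ?_⟩
      rw [e, imb_insert_singleton, if_neg hx, zero_add]

/-- The side to which a hash confines its ball: `1` if both bins are among `0, 1`, `-1` if both are
among `2, 3`, and `0` if the strategy can choose the side. -/
def bias (p : BinPair) : ℤ :=
  if p.1.1.val < 2 ∧ p.1.2.val < 2 then 1 else if 2 ≤ p.1.1.val ∧ 2 ≤ p.1.2.val then -1 else 0

theorem sum_bias_sq : ∑ p : BinPair, bias p * bias p = 4 := by decide

theorem sum_bias : ∑ p : BinPair, bias p = 0 := by decide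

theorem side_of_bias {p : BinPair} (hp : bias p ≠ 0) {b : Fin 4} (hb : b = p.1.1 ∨ b = p.1.2) :
    side b = bias p := by
  have key : ∀ p : BinPair, bias p ≠ 0 → ∀ b : Fin 4, (b = p.1.1 ∨ b = p.1.2) →
      (if b = 0 ∨ b = 1 then (1 : ℤ) else -1) = bias p := by decide
  rw [← key p hp b hb]
  unfold side
  split_ifs <;> simp

/-- The number of balls of `A` with hash `p`. -/
def cnt (h : ℕ → BinPair) (p : BinPair) (A : Finset ℕ) : ℕ := (A.filter (fun x => h x = p)).card

theorem sum_eq_sum_cnt (h : ℕ → BinPair) (A : Finset ℕ) (Φ : BinPair → ℝ) :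
    ∑ a ∈ A, Φ (h a) = ∑ p : BinPair, cnt h p A * Φ p := by
  rw [← Finset.sum_fiberwise A h (fun a => Φ (h a))]
  refine Finset.sum_congr rfl fun p _ => ?_
  rw [Finset.sum_congr rfl (g := fun _ => Φ p)
    (fun x hx => by rw [(Finset.mem_filter.1 hx).2])]
  rw [Finset.sum_const, nsmul_eq_mul, cnt]

/-- When the balls of `X ∪ Q` are inserted in random order, each ball ends up, on average, on a
side that depends on its hash only. So a surplus of hashes that force the bins `0, 1` in `X` makes
`X` more imbalanced than `Q`, whatever the strategy does with the other hashes. -/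
theorem sum_orders_ge (S : Strategy) (h : ℕ → BinPair) (s : State) {X Q : Finset ℕ}
    (h0 : ∀ x ∈ X ∪ Q, imb {x} s = 0) {q a : ℝ}
    (hX : ∀ p, (cnt h p X : ℝ) = q + a * bias p) :
    (orders (X ∪ Q)).card * (4 * a - ∑ p : BinPair, |(cnt h p Q : ℝ) - q|) ≤
      ∑ l ∈ orders (X ∪ Q), (imbAfter S h s X l - imbAfter S h s Q l) := by
  classical
  set W := X ∪ Q with hW
  set N : ℝ := ((orders W).card : ℝ) with hN
  have hNpos : 0 < N := by
    rw [hN]; exact_mod_cast (orders_nonempty W).card_pos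
  -- the mean side of the balls with hash `p`; if there are none, any admissible value does
  let Φ : BinPair → ℝ := fun p =>
    if hp : ∃ x ∈ W, h x = p then (∑ l ∈ orders W, imbAfter S h s {hp.choose} l) / N else bias p
  have hΦ : ∀ x ∈ W, ∑ l ∈ orders W, imbAfter S h s {x} l = N * Φ (h x) := by
    intro x hx
    have hp : ∃ y ∈ W, h y = h x := ⟨x, hx, rfl⟩
    simp only [Φ, dif_pos hp]
    rw [mul_div_cancel₀ _ hNpos.ne']
    refine sum_orders_eq hx hp.choose_spec.1 hp.choose_spec.2.symm ?_
    rw [h0 x hx, h0 _ hp.choose_spec.1]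
  have hval : ∀ x ∈ W, ∀ l ∈ orders W, ∃ b, (b = (h x).1.1 ∨ b = (h x).1.2) ∧
      imbAfter S h s {x} l = side b := by
    intro x hx l hl
    obtain ⟨b, hb, e⟩ := imbAfter_singleton (S := S) (h := h) (s := s) (orders_nodup hl)
      ((mem_of_mem_orders hl x).2 hx)
    exact ⟨b, hb, by rw [e, h0 x hx, add_zero]⟩
  have hΦbias : ∀ p, bias p ≠ 0 → Φ p = bias p := by
    intro p hpb
    by_cases hp : ∃ x ∈ W, h x = p
    · obtain ⟨x, hx, rfl⟩ := hp
      have h1 := hΦ x hx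
      rw [Finset.sum_congr rfl (g := fun _ => (bias (h x) : ℝ))] at h1
      · rw [Finset.sum_const, nsmul_eq_mul] at h1
        exact (mul_left_cancel₀ hNpos.ne' h1).symm
      · intro l hl
        obtain ⟨b, hb, e⟩ := hval x hx l hl
        rw [e, side_of_bias hpb hb]
    · simp only [Φ, dif_neg hp]
  have hΦabs : ∀ p, |Φ p| ≤ 1 := by
    intro p
    by_cases hp : ∃ x ∈ W, h x = p
    · obtain ⟨x, hx, rfl⟩ := hp
      have h1 := hΦ x hx
      have h2 : |∑ l ∈ orders W, imbAfter S h s {x} l| ≤ N := by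
        refine (Finset.abs_sum_le_sum_abs _ _).trans ?_
        rw [hN, ← nsmul_one (orders W).card]
        refine Finset.sum_le_card_nsmul _ _ _ fun l hl => ?_
        obtain ⟨b, _, e⟩ := hval x hx l hl
        rw [e, abs_side]
      rw [h1, abs_mul, abs_of_pos hNpos] at h2
      exact le_of_mul_le_mul_left (by linarith) hNpos
    · simp only [Φ, dif_neg hp]
      have : ∀ p : BinPair, |bias p| ≤ 1 := by decide
      exact_mod_cast this p
  have hsum : ∀ A ⊆ W, ∑ l ∈ orders W, imbAfter S h s A l = N * ∑ p, cnt h p A * Φ p := by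
    intro A hA
    have : ∀ l, imbAfter S h s A l = ∑ x ∈ A, imbAfter S h s {x} l := fun l => imb_eq_sum _ _
    simp_rw [this]
    rw [Finset.sum_comm, ← sum_eq_sum_cnt, Finset.mul_sum]
    exact Finset.sum_congr rfl fun x hx => hΦ x (hA hx)
  rw [Finset.sum_sub_distrib, hsum X Finset.subset_union_left, hsum Q Finset.subset_union_right,
    ← mul_sub]
  refine mul_le_mul_of_nonneg_left ?_ hNpos.le
  have h4 : (4 : ℝ) = ∑ p : BinPair, (bias p : ℝ) * Φ p := by
    rw [Finset.sum_congr rfl (g := fun p => ((bias p * bias p : ℤ) : ℝ))]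
    · rw [← Int.cast_sum, sum_bias_sq]; norm_num
    · intro p _
      by_cases hp : bias p = 0
      · simp [hp]
      · rw [hΦbias p hp]; push_cast; ring
  rw [h4, Finset.sum_mul, ← Finset.sum_sub_distrib, ← Finset.sum_sub_distrib]
  refine Finset.sum_le_sum fun p _ => ?_
  rw [hX p]
  have h5 : ((cnt h p Q : ℝ) - q) * Φ p ≤ |(cnt h p Q : ℝ) - q| := by
    refine (le_abs_self _).trans ?_
    rw [abs_mul]
    exact mul_le_of_le_one_right (abs_nonneg _) (hΦabs p)
  nlinarith

section

/-! ### Measurability -/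

/-- Every set of states is measurable. -/
instance instMeasurableSpaceState : MeasurableSpace State := ⊤

instance instDiscreteState : DiscreteMeasurableSpace State := ⟨fun _ => trivial⟩

instance instCountableRequest : Countable Request := by
  refine Function.Injective.countable (β := BinPair ⊕ ℕ)
    (f := fun r => match r with
      | Request.insert p => Sum.inl p
      | Request.delete r => Sum.inr r) ?_
  intro a b hab
  cases a <;> cases b <;> simp_all

instance instCountableState : Countable State := by
  refine Function.Injective.countable (β := List (ℕ × Fin 4) × List Request)
    (f := fun s => (s.present, s.history)) ?_
  rintro ⟨a, b⟩ ⟨c, d⟩ hab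
  simp_all

theorem measurable_eval_countable {Z α β : Type*} [MeasurableSpace Z] [MeasurableSpace α]
    [Countable α] [DiscreteMeasurableSpace α] [MeasurableSpace β] {f : Z → α → β} {g : Z → α}
    (hf : ∀ a, Measurable fun z => f z a) (hg : Measurable g) : Measurable fun z => f z (g z) := by
  have h : Measurable (Function.uncurry fun (a : α) (z : Z) => f z a) :=
    measurable_from_prod_countable_right hf
  exact h.comp (hg.prodMk measurable_id)

variable {Z : Type*} [MeasurableSpace Z]

theorem measurable_step {H : Z → ℕ → BinPair} {S : Z → Strategy}
    (hH : ∀ x, Measurable fun z => H z x) (hS : ∀ hist p, Measurable fun z => S z hist p)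
    {s : Z → State} (hs : Measurable s) (o : Op) :
    Measurable fun z => step (S z) (H z) (s z) o := by
  cases o with
  | delete x =>
    exact (measurable_from_top (f := fun t : State =>
      step (fun _ _ => true) (fun _ => ⟨(0, 1), by decide⟩) t (Op.delete x))).comp hs
  | insert x =>
    have h1 : ∀ t : State, ∀ p : BinPair,
        Measurable fun z => (⟨(x, chosenBin (S z) t.history p) :: t.present,
          Request.insert p :: t.history⟩ : State) := by
      intro t p
      exact (measurable_from_top (f := fun c : Bool =>
        (⟨(x, if c then p.1.1 else p.1.2) :: t.present, Request.insert p :: t.history⟩ :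
          State))).comp (hS t.history p)
    have h2 : ∀ p : BinPair, Measurable fun z =>
        (⟨(x, chosenBin (S z) (s z).history p) :: (s z).present,
          Request.insert p :: (s z).history⟩ : State) := fun p =>
      measurable_eval_countable (f := fun z (t : State) =>
        (⟨(x, chosenBin (S z) t.history p) :: t.present, Request.insert p :: t.history⟩ : State))
        (fun t => h1 t p) hs
    exact measurable_eval_countable (f := fun z (p : BinPair) =>
        (⟨(x, chosenBin (S z) (s z).history p) :: (s z).present,
          Request.insert p :: (s z).history⟩ : State)) h2 (hH x)

theorem measurable_run {H : Z → ℕ → BinPair} {S : Z → Strategy}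
    (hH : ∀ x, Measurable fun z => H z x) (hS : ∀ hist p, Measurable fun z => S z hist p)
    (ops : List Op) : Measurable fun z => run (S z) (H z) ops := by
  unfold run
  suffices ∀ s : Z → State, Measurable s →
      Measurable fun z => ops.foldl (step (S z) (H z)) (s z) from
    this _ measurable_const
  induction ops with
  | nil => exact fun s hs => hs
  | cons o ops ih =>
    intro s hs
    exact ih _ (measurable_step hH hS hs o)

theorem measurableSet_reachesLoad {H : Z → ℕ → BinPair} {S : Z → Strategy}
    (hH : ∀ x, Measurable fun z => H z x) (hS : ∀ hist p, Measurable fun z => S z hist p)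
    (ops : List Op) (L : ℝ) : MeasurableSet {z | ReachesLoad (S z) (H z) ops L} := by
  have : {z | ReachesLoad (S z) (H z) ops L} =
      ⋃ t ∈ Finset.range (ops.length + 1), ⋃ b : Fin 4,
        (fun z => run (S z) (H z) (ops.take t)) ⁻¹' {s | L ≤ (load s b : ℝ)} := by
    ext z
    simp [ReachesLoad]
  rw [this]
  refine Finset.measurableSet_biUnion _ fun t _ => MeasurableSet.iUnion fun b => ?_
  exact measurable_run hH hS _ trivial

/-! ### Mean imbalances -/

/-- The mean imbalance of the balls of `A` after the operations `ops`. -/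
noncomputable def meanImb (ν : Measure Z) (H : Z → ℕ → BinPair) (S : Z → Strategy)
    (A : Finset ℕ) (ops : List Op) : ℝ :=
  ∫ z, imb A (run (S z) (H z) ops) ∂ν

/-- The situation in which the adversary plays: hashes and strategy are random according to `ν`,
and the `12 s ^ 2` balls of the reserved set `X` have `s ^ 2 + 4 s * bias p` balls with hash `p`.
The balls from `n₀` on are fresh: in each block of them, the number of balls with
a given hash has mean deviation at most `s` from `s ^ 2`. -/
structure Arena (ν : Measure Z) (H : Z → ℕ → BinPair) (S : Z → Strategy) (m s : ℕ) (δ : ℝ)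
    (X : Finset ℕ) (n₀ : ℕ) : Prop where
  measurable_hash : ∀ x, Measurable fun z => H z x
  measurable_strategy : ∀ hist p, Measurable fun z => S z hist p
  s_pos : 0 < s
  le_m : 26 * s ^ 2 * (12 * s ^ 2) ≤ m
  delta_le : 4 * δ + 1 ≤ s / 50
  delta_nonneg : 0 ≤ δ
  card_X : X.card = 12 * s ^ 2
  X_lt : ∀ x ∈ X, x < n₀
  cnt_X : ∀ᵐ z ∂ν, ∀ p, (cnt (H z) p X : ℝ) = (s : ℝ) ^ 2 + 4 * s * bias p
  cnt_fresh : ∀ n, n₀ ≤ n → ∀ p,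
    ∫ z, |(cnt (H z) p (Finset.Ico n (n + 12 * s ^ 2)) : ℝ) - (s : ℝ) ^ 2| ∂ν ≤ s

/-- The system is full, the balls of `X` are absent, all balls from `n` on are fresh, and the sets
`B i` are disjoint blocks of `12 s ^ 2` balls present. -/
structure Config (m s : ℕ) (X : Finset ℕ) (n₀ : ℕ) (ops : List Op)
    (B : Fin (26 * s ^ 2) → Finset ℕ) (n : ℕ) : Prop where
  legal : Legal m ∅ ops
  full : (curr ∅ ops).card = m
  subset : ∀ i, B i ⊆ curr ∅ ops
  disj : ∀ i j, i ≠ j → Disjoint (B i) (B j)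
  card_block : ∀ i, (B i).card = 12 * s ^ 2
  lt : ∀ x ∈ curr ∅ ops, x < n
  le : n₀ ≤ n
  disj_X : Disjoint X (curr ∅ ops)

theorem meanImb_append_of_ne {ν : Measure Z} {H : Z → ℕ → BinPair}
    {S : Z → Strategy} {A : Finset ℕ} (pre : List Op) {ops : List Op}
    (ho : ∀ o ∈ ops, o.ball ∉ A) :
    meanImb ν H S A (pre ++ ops) = meanImb ν H S A pre := by
  unfold meanImb
  simp_rw [imb_run_append_of_ne pre ho]

section

variable {ν : Measure Z} [IsProbabilityMeasure ν] {H : Z → ℕ → BinPair} {S : Z → Strategy}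
  {m s : ℕ} {δ : ℝ} {X : Finset ℕ} {n₀ : ℕ}

theorem Arena.integrable_imb (ha : Arena ν H S m s δ X n₀) {ops : List Op}
    (hl : Legal m ∅ ops) (A : Finset ℕ) :
    Integrable (fun z => imb A (run (S z) (H z) ops)) ν := by
  refine Integrable.of_bound (C := A.card) ?_ ?_
  · exact ((measurable_from_top (f := imb A)).comp
      (measurable_run ha.measurable_hash ha.measurable_strategy ops)).aestronglyMeasurable
  · exact Filter.Eventually.of_forall fun z => abs_imb_le (tracks_run hl) A

theorem Arena.meanImb_union (ha : Arena ν H S m s δ X n₀) {ops : List Op}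
    (hl : Legal m ∅ ops) {A B : Finset ℕ} (hAB : Disjoint A B) :
    meanImb ν H S (A ∪ B) ops = meanImb ν H S A ops + meanImb ν H S B ops := by
  unfold meanImb
  rw [← integral_add (ha.integrable_imb hl A) (ha.integrable_imb hl B)]
  simp_rw [imb_union hAB]

theorem abs_meanImb_le {ops : List Op} (hl : Legal m ∅ ops) (A : Finset ℕ) :
    |meanImb ν H S A ops| ≤ A.card := by
  have := norm_integral_le_of_norm_le_const (μ := ν) (C := (A.card : ℝ))
    (f := fun z => imb A (run (S z) (H z) ops))
    (Filter.Eventually.of_forall fun z => abs_imb_le (tracks_run hl) A)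
  simpa [meanImb] using this

/-- If overload is unlikely, a full system is nearly balanced on average. -/
theorem Arena.abs_meanImb_all_le (ha : Arena ν H S m s δ X n₀) {ops : List Op}
    (hl : Legal m ∅ ops) (hc : (curr ∅ ops).card = m)
    (hp : ν.real {z | ReachesLoad (S z) (H z) ops ((m : ℝ) / 4 + δ)} < 1 / m) :
    |meanImb ν H S (curr ∅ ops) ops| ≤ s / 50 := by
  set R := {z | ReachesLoad (S z) (H z) ops ((m : ℝ) / 4 + δ)} with hR
  have hRm : MeasurableSet R :=
    measurableSet_reachesLoad ha.measurable_hash ha.measurable_strategy ops _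
  have hm : (0 : ℝ) < m := by
    by_contra h
    have h0 : (m : ℝ) = 0 := le_antisymm (not_lt.1 h) (Nat.cast_nonneg m)
    rw [h0, div_zero] at hp
    exact absurd hp (not_lt.2 measureReal_nonneg)
  have hbound : ∀ z, |imb (curr ∅ ops) (run (S z) (H z) ops)| ≤
      4 * δ + R.indicator (fun _ => (m : ℝ)) z := by
    intro z
    by_cases hz : z ∈ R
    · rw [Set.indicator_of_mem hz]
      refine (abs_imb_le (tracks_run hl) _).trans ?_
      rw [hc]; linarith [ha.delta_nonneg]
    · rw [Set.indicator_of_notMem hz, add_zero]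
      exact abs_imb_run_le hl hc hz
  have hint : Integrable (fun z => 4 * δ + R.indicator (fun _ => (m : ℝ)) z) ν :=
    (integrable_const _).add ((integrable_const _).indicator hRm)
  calc |meanImb ν H S (curr ∅ ops) ops|
      ≤ ∫ z, |imb (curr ∅ ops) (run (S z) (H z) ops)| ∂ν := abs_integral_le_integral_abs
    _ ≤ ∫ z, (4 * δ + R.indicator (fun _ => (m : ℝ)) z) ∂ν :=
        integral_mono (ha.integrable_imb hl _).abs hint hbound
    _ = 4 * δ + ν.real R * m := by
        rw [integral_add (integrable_const _) ((integrable_const _).indicator hRm),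
          integral_indicator_const _ hRm]
        simp
    _ ≤ 4 * δ + 1 := by
        have := mul_le_mul_of_nonneg_right hp.le hm.le
        rw [one_div, inv_mul_cancel₀ hm.ne'] at this
        linarith
    _ ≤ s / 50 := ha.delta_le

theorem card_binPair : Fintype.card BinPair = 12 := by decide

theorem integrable_cnt (hH : ∀ x, Measurable fun z => H z x) (p : BinPair) (A : Finset ℕ) (q : ℝ) :
    Integrable (fun z => |(cnt (H z) p A : ℝ) - q|) ν := by
  refine Integrable.abs (Integrable.sub ?_ (integrable_const _))
  have h1 : ∀ z, (cnt (H z) p A : ℝ) = ∑ x ∈ A, if H z x = p then (1 : ℝ) else 0 := by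
    intro z; simp [cnt]
  simp_rw [h1]
  refine integrable_finsetSum _ fun x _ => Integrable.of_bound (C := 1) ?_ ?_
  · exact ((measurable_of_countable (fun c : BinPair => if c = p then (1 : ℝ) else 0)).comp
      (hH x)).aestronglyMeasurable
  · refine Filter.Eventually.of_forall fun z => ?_
    split_ifs <;> simp

/-- Some order of insertion of `X` together with a fresh block `Q` makes the mean imbalance of `X`
exceed the one of `Q`. -/
theorem Arena.exists_order (ha : Arena ν H S m s δ X n₀) {pre : List Op} (hl : Legal m ∅ pre)
    {n : ℕ} (hn : n₀ ≤ n) (hX : Disjoint X (curr ∅ pre)) (hlt : ∀ x ∈ curr ∅ pre, x < n)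
    (hm : (curr ∅ pre).card + 2 * (12 * s ^ 2) ≤ m) :
    ∃ l ∈ orders (X ∪ Finset.Ico n (n + 12 * s ^ 2)),
      meanImb ν H S (Finset.Ico n (n + 12 * s ^ 2)) (pre ++ l.map Op.insert) + 4 * s ≤
        meanImb ν H S X (pre ++ l.map Op.insert) := by
  set Q := Finset.Ico n (n + 12 * s ^ 2) with hQ
  have hQd : Disjoint Q (curr ∅ pre) := by
    rw [Finset.disjoint_left]
    intro x hx hx'
    have := hlt x hx'
    rw [hQ, Finset.mem_Ico] at hx
    omega
  have hWd : Disjoint (X ∪ Q) (curr ∅ pre) := Finset.disjoint_union_left.2 ⟨hX, hQd⟩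
  have hcW : (X ∪ Q).card ≤ 2 * (12 * s ^ 2) := by
    refine (Finset.card_union_le _ _).trans ?_
    rw [ha.card_X, hQ, Nat.card_Ico]; omega
  have hleg : ∀ l ∈ orders (X ∪ Q), Legal m ∅ (pre ++ l.map Op.insert) := by
    intro l hlo
    rw [legal_append]
    refine ⟨hl, legal_inserts _ _ _ (orders_nodup hlo) (fun x hx => ?_) ?_⟩
    · exact Finset.disjoint_left.1 hWd ((mem_of_mem_orders hlo x).1 hx)
    · rw [length_of_mem_orders hlo]; omega
  have hpt : ∀ᵐ z ∂ν, ((orders (X ∪ Q)).card : ℝ) *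
      (4 * (4 * s) - ∑ p : BinPair, |(cnt (H z) p Q : ℝ) - (s : ℝ) ^ 2|) ≤
      ∑ l ∈ orders (X ∪ Q), (imb X (run (S z) (H z) (pre ++ l.map Op.insert)) -
        imb Q (run (S z) (H z) (pre ++ l.map Op.insert))) := by
    filter_upwards [ha.cnt_X] with z hz
    have := sum_orders_ge (S z) (H z) (run (S z) (H z) pre) (X := X) (Q := Q)
      (fun x hx => imb_eq_zero (tracks_run hl)
        (Finset.disjoint_singleton_left.2 (Finset.disjoint_left.1 hWd hx))) hz
    simp only [imbAfter, ← run_append] at this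
    exact this
  have hint2 : Integrable (fun z => ∑ p : BinPair, |(cnt (H z) p Q : ℝ) - (s : ℝ) ^ 2|) ν :=
    integrable_finsetSum _ fun p _ => integrable_cnt ha.measurable_hash p Q _
  have hint3 : ∀ l ∈ orders (X ∪ Q), Integrable (fun z =>
      imb X (run (S z) (H z) (pre ++ l.map Op.insert)) -
        imb Q (run (S z) (H z) (pre ++ l.map Op.insert))) ν := fun l hlo =>
    (ha.integrable_imb (hleg l hlo) X).sub (ha.integrable_imb (hleg l hlo) Q)
  have hI := integral_mono_ae (((integrable_const _).sub hint2).const_mul _)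
    (integrable_finsetSum _ hint3) hpt
  simp only [Pi.sub_apply] at hI
  rw [integral_const_mul, integral_sub (integrable_const _) hint2,
    integral_finsetSum _ (fun p _ => integrable_cnt ha.measurable_hash p Q _),
    integral_finsetSum _ (hint3)] at hI
  have hsum : ∑ p : BinPair, ∫ z, |(cnt (H z) p Q : ℝ) - (s : ℝ) ^ 2| ∂ν ≤ 12 * s := by
    refine (Finset.sum_le_card_nsmul _ _ (s : ℝ) fun p _ => ha.cnt_fresh n hn p).trans ?_
    rw [Finset.card_univ, card_binPair]
    simp
  have hI2 : ∑ l ∈ orders (X ∪ Q), (4 * s : ℝ) ≤ ∑ l ∈ orders (X ∪ Q),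
      (meanImb ν H S X (pre ++ l.map Op.insert) - meanImb ν H S Q (pre ++ l.map Op.insert)) := by
    rw [Finset.sum_const, nsmul_eq_mul]
    have e : ∀ l ∈ orders (X ∪ Q), meanImb ν H S X (pre ++ l.map Op.insert) -
        meanImb ν H S Q (pre ++ l.map Op.insert) =
        ∫ z, (imb X (run (S z) (H z) (pre ++ l.map Op.insert)) -
          imb Q (run (S z) (H z) (pre ++ l.map Op.insert))) ∂ν := fun l hlo =>
      (integral_sub (ha.integrable_imb (hleg l hlo) X) (ha.integrable_imb (hleg l hlo) Q)).symm
    rw [Finset.sum_congr rfl e]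
    refine le_trans (mul_le_mul_of_nonneg_left ?_ (Nat.cast_nonneg _)) hI
    simp only [integral_const, probReal_univ, smul_eq_mul, one_mul]
    linarith
  obtain ⟨l, hlo, h⟩ := Finset.exists_le_of_sum_le (orders_nonempty _) hI2
  exact ⟨l, hlo, by linarith⟩

end

end

section

/-! ### Replacing two blocks -/

theorem ball_notMem_of_inserts {A : Finset ℕ} {l : List ℕ} (h : ∀ x ∈ l, x ∉ A) :
    ∀ o ∈ l.map Op.insert, o.ball ∉ A := by
  intro o ho
  obtain ⟨x, hx, rfl⟩ := List.mem_map.1 ho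
  exact h x hx

theorem ball_notMem_of_deletes {A : Finset ℕ} {l : List ℕ} (h : ∀ x ∈ l, x ∉ A) :
    ∀ o ∈ l.map Op.delete, o.ball ∉ A := by
  intro o ho
  obtain ⟨x, hx, rfl⟩ := List.mem_map.1 ho
  exact h x hx

variable {Z : Type*} [MeasurableSpace Z] {ν : Measure Z} [IsProbabilityMeasure ν]
  {H : Z → ℕ → BinPair} {S : Z → Strategy} {m s : ℕ} {δ : ℝ} {X : Finset ℕ} {n₀ : ℕ}

/-- Two blocks are deleted and replaced by `X` and a fresh block `Q` in a suitable order; then `X`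
is replaced by another fresh block, which has to make up for it. The latter takes the place of block
`i`, and `Q` that of block `j`. Here `x` is the mean imbalance of `X` while it is present, and `τ₁` the
mean imbalance of all balls at that time. -/
theorem Arena.replace (ha : Arena ν H S m s δ X n₀) {ops : List Op}
    {B : Fin (26 * s ^ 2) → Finset ℕ} {n : ℕ} (hc : Config m s X n₀ ops B n)
    {i j : Fin (26 * s ^ 2)} (hij : i ≠ j)
    (hno : ∀ ext, Legal m ∅ (ops ++ ext) → ext.length ≤ 6 * (12 * s ^ 2) →
      ν.real {z | ReachesLoad (S z) (H z) (ops ++ ext) ((m : ℝ) / 4 + δ)} < 1 / m) :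
    ∃ ext B' n', ext.length = 6 * (12 * s ^ 2) ∧ Config m s X n₀ (ops ++ ext) B' n' ∧
      (∀ l, l ≠ i → l ≠ j →
        meanImb ν H S (B' l) (ops ++ ext) = meanImb ν H S (B l) ops) ∧
      ∃ x τ₁ : ℝ, |τ₁| ≤ s / 50 ∧
        x + meanImb ν H S (B' j) (ops ++ ext) =
          meanImb ν H S (B i) ops + meanImb ν H S (B j) ops +
            (τ₁ - meanImb ν H S (curr ∅ ops) ops) ∧
        meanImb ν H S (B' i) (ops ++ ext) =
          x + (meanImb ν H S (curr ∅ (ops ++ ext)) (ops ++ ext) - τ₁) ∧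
        meanImb ν H S (B' j) (ops ++ ext) + 4 * s ≤ x := by
  classical
  have hcX := ha.card_X
  have hcB := hc.card_block
  have hnn := hc.le
  obtain ⟨k, hk⟩ : ∃ k, k = 12 * s ^ 2 := ⟨_, rfl⟩
  rw [← hk] at hcX hno ⊢
  simp only [← hk] at hcB
  set P := curr ∅ ops with hP
  set U := B i ∪ B j with hU
  have hBij := hc.disj i j hij
  have hUP : U ⊆ P := Finset.union_subset (hc.subset i) (hc.subset j)
  have hUc : U.card = 2 * k := by
    rw [hU, Finset.card_union_of_disjoint hBij, hcB, hcB]; omega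
  set R := P \ U with hR
  have hRc : R.card + 2 * k = m := by
    have := Finset.card_sdiff_add_card_eq_card hUP
    rw [hUc, hc.full] at this
    exact this
  have hRP : R ⊆ P := Finset.sdiff_subset
  have hRU : Disjoint R U := Finset.sdiff_disjoint
  set d := U.toList.map Op.delete with hd
  have hcd : curr ∅ (ops ++ d) = R := by
    rw [curr_append, hd, curr_deletes, Finset.toList_toFinset]
  have hld : Legal m ∅ (ops ++ d) :=
    (legal_append _ _ _ _).2 ⟨hc.legal, legal_deletes _ _ _ U.nodup_toList
      (fun x hx => hUP (Finset.mem_toList.1 hx))⟩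
  have hXP := hc.disj_X
  have hXR : Disjoint X R := hXP.mono_right hRP
  obtain ⟨l, hlo, hl⟩ := ha.exists_order hld hc.le (by rwa [hcd])
    (by rw [hcd]; exact fun x hx => hc.lt x (hRP hx)) (by rw [hcd, ← hk]; omega)
  rw [← hk] at hlo hl
  set Q := Finset.Ico n (n + k) with hQ
  set Q' := Finset.Ico (n + k) (n + 2 * k) with hQ'
  have hXn : ∀ x ∈ X, x < n := fun x hx => (ha.X_lt x hx).trans_le hnn
  have hQm : ∀ x ∈ Q, n ≤ x ∧ x < n + k := fun x hx => Finset.mem_Ico.1 hx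
  have hQm' : ∀ x ∈ Q', n + k ≤ x ∧ x < n + 2 * k := fun x hx => Finset.mem_Ico.1 hx
  have hdis : ∀ {A C : Finset ℕ}, (∀ x ∈ A, x ∉ C) → Disjoint A C :=
    fun h => Finset.disjoint_left.2 h
  have hPQ : Disjoint P Q := hdis fun x hx hx' => by
    have := hc.lt x hx; have := hQm x hx'; omega
  have hPQ' : Disjoint P Q' := hdis fun x hx hx' => by
    have := hc.lt x hx; have := hQm' x hx'; omega
  have hXQ : Disjoint X Q := hdis fun x hx hx' => by
    have := hXn x hx; have := hQm x hx'; omega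
  have hXQ' : Disjoint X Q' := hdis fun x hx hx' => by
    have := hXn x hx; have := hQm' x hx'; omega
  have hQQ' : Disjoint Q Q' := hdis fun x hx hx' => by
    have := hQm x hx; have := hQm' x hx'; omega
  have hQc : Q.card = k := by rw [hQ, Nat.card_Ico]; omega
  have hQc' : Q'.card = k := by rw [hQ', Nat.card_Ico]; omega
  have hXR' := Finset.disjoint_left.1 hXR
  have hRQ := hPQ.mono_left hRP
  have hRQ' := hPQ'.mono_left hRP
  set i1 := l.map Op.insert with hi1
  set ops1 := ops ++ d ++ i1 with hops1
  have hlF : l.toFinset = X ∪ Q := by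
    ext x; rw [List.mem_toFinset, mem_of_mem_orders hlo]
  have hc1 : curr ∅ ops1 = R ∪ (X ∪ Q) := by
    rw [hops1, curr_append, hcd, hi1, curr_inserts, hlF]
  have hXQc : (X ∪ Q).card = 2 * k := by
    rw [Finset.card_union_of_disjoint hXQ, hcX, hQc]; omega
  have hRXQ : Disjoint R (X ∪ Q) := Finset.disjoint_union_right.2 ⟨hXR.symm, hRQ⟩
  have hl1 : Legal m ∅ ops1 := by
    rw [hops1, legal_append]
    refine ⟨hld, legal_inserts _ _ _ (orders_nodup hlo) (fun x hx => ?_) ?_⟩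
    · rw [hcd]
      exact Finset.disjoint_right.1 hRXQ ((mem_of_mem_orders hlo x).1 hx)
    · rw [hcd, length_of_mem_orders hlo, hXQc]; omega
  set d2 := X.toList.map Op.delete with hd2
  have hc2 : curr ∅ (ops1 ++ d2) = R ∪ Q := by
    rw [curr_append, hc1, hd2, curr_deletes, Finset.toList_toFinset]
    ext x
    have h1 := fun h : x ∈ X => Finset.disjoint_left.1 hXR h
    have h2 := fun h : x ∈ X => Finset.disjoint_left.1 hXQ h
    simp only [Finset.mem_sdiff, Finset.mem_union]; tauto
  have hl2 : Legal m ∅ (ops1 ++ d2) :=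
    (legal_append _ _ _ _).2 ⟨hl1, legal_deletes _ _ _ X.nodup_toList
      (fun x hx => by rw [hc1]; simp [Finset.mem_toList.1 hx])⟩
  set i2 := Q'.toList.map Op.insert with hi2
  have hc3 : curr ∅ (ops1 ++ d2 ++ i2) = R ∪ (Q ∪ Q') := by
    rw [curr_append, hc2, hi2, curr_inserts, Finset.toList_toFinset, Finset.union_assoc]
  have hRQc : (R ∪ Q).card = R.card + k := by rw [Finset.card_union_of_disjoint hRQ, hQc]
  have hl3 : Legal m ∅ (ops1 ++ d2 ++ i2) := by
    rw [legal_append]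
    refine ⟨hl2, legal_inserts _ _ _ Q'.nodup_toList (fun x hx => ?_) ?_⟩
    · rw [hc2]
      have hx' := Finset.mem_toList.1 hx
      simp only [Finset.mem_union, not_or]
      exact ⟨Finset.disjoint_right.1 hRQ' hx', Finset.disjoint_right.1 hQQ' hx'⟩
    · rw [hc2, Finset.length_toList, hQc', hRQc]; omega
  have hRQQ : Disjoint R (Q ∪ Q') := Finset.disjoint_union_right.2 ⟨hRQ, hRQ'⟩
  have hf3 : (R ∪ (Q ∪ Q')).card = m := by
    rw [Finset.card_union_of_disjoint hRQQ, Finset.card_union_of_disjoint hQQ', hQc, hQc']; omega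
  set ext := d ++ i1 ++ d2 ++ i2 with hext
  have hext' : ops ++ ext = ops1 ++ d2 ++ i2 := by simp [hext, hops1]
  have hextl : ext.length = 6 * k := by
    simp only [hext, List.length_append, hd, hi1, hd2, hi2, List.length_map,
      Finset.length_toList, hUc, length_of_mem_orders hlo, hXQc, hcX, hQc']
    omega
  set B' := Function.update (Function.update B i Q') j Q with hB'
  have hB'j : B' j = Q := by simp [hB']
  have hB'i : B' i = Q' := by simp [hB', Function.update_of_ne hij]
  have hB'l : ∀ a, a ≠ i → a ≠ j → B' a = B a := by
    intro a h1 h2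
    simp [hB', h1, h2]
  have hBR : ∀ a, a ≠ i → a ≠ j → B a ⊆ R := by
    intro a h1 h2 x hx
    rw [hR, hU]
    simp only [Finset.mem_sdiff, Finset.mem_union, not_or]
    exact ⟨hc.subset a hx, Finset.disjoint_left.1 (hc.disj a i h1) hx,
      Finset.disjoint_left.1 (hc.disj a j h2) hx⟩
  have hB'3 : ∀ a, (a = i ∧ B' a = Q') ∨ (a = j ∧ B' a = Q) ∨
      (a ≠ i ∧ a ≠ j ∧ B' a = B a ∧ B a ⊆ R) := by
    intro a
    by_cases h1 : a = i
    · exact Or.inl ⟨h1, h1 ▸ hB'i⟩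
    by_cases h2 : a = j
    · exact Or.inr (Or.inl ⟨h2, h2 ▸ hB'j⟩)
    exact Or.inr (Or.inr ⟨h1, h2, hB'l a h1 h2, hBR a h1 h2⟩)
  -- balls of `R` are not touched, and those of `Q` are not touched after their insertion
  have avoid_d : ∀ {A}, A ⊆ R → ∀ o ∈ d, o.ball ∉ A := fun hA =>
    ball_notMem_of_deletes fun x hx hx' =>
      Finset.disjoint_left.1 hRU (hA hx') (Finset.mem_toList.1 hx)
  have avoid_i1 : ∀ {A}, A ⊆ R → ∀ o ∈ i1, o.ball ∉ A := fun hA =>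
    ball_notMem_of_inserts fun x hx hx' =>
      Finset.disjoint_left.1 hRXQ (hA hx') ((mem_of_mem_orders hlo x).1 hx)
  have avoid_d2 : ∀ {A}, A ⊆ R ∪ Q → ∀ o ∈ d2, o.ball ∉ A := fun hA =>
    ball_notMem_of_deletes fun x hx hx' => by
      have hxX := Finset.mem_toList.1 hx
      rcases Finset.mem_union.1 (hA hx') with h | h
      · exact Finset.disjoint_left.1 hXR hxX h
      · exact Finset.disjoint_left.1 hXQ hxX h
  have avoid_i2 : ∀ {A}, A ⊆ R ∪ Q → ∀ o ∈ i2, o.ball ∉ A := fun hA =>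
    ball_notMem_of_inserts fun x hx hx' => by
      have hxX := Finset.mem_toList.1 hx
      rcases Finset.mem_union.1 (hA hx') with h | h
      · exact Finset.disjoint_left.1 hRQ' h hxX
      · exact Finset.disjoint_left.1 hQQ' h hxX
  have mean1 : ∀ {A}, A ⊆ R → meanImb ν H S A ops1 = meanImb ν H S A ops := fun hA => by
    rw [hops1, meanImb_append_of_ne _ (avoid_i1 hA), meanImb_append_of_ne _ (avoid_d hA)]
  have mean3 : ∀ {A}, A ⊆ R ∪ Q →
      meanImb ν H S A (ops1 ++ d2 ++ i2) = meanImb ν H S A ops1 := fun hA => by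
    rw [meanImb_append_of_ne _ (avoid_i2 hA), meanImb_append_of_ne _ (avoid_d2 hA)]
  have hτ : meanImb ν H S P ops =
      meanImb ν H S R ops + (meanImb ν H S (B i) ops + meanImb ν H S (B j) ops) := by
    rw [← ha.meanImb_union hc.legal hBij, ← ha.meanImb_union hc.legal hRU,
      Finset.sdiff_union_of_subset hUP]
  have hτ1 : meanImb ν H S (curr ∅ ops1) ops1 =
      meanImb ν H S R ops + (meanImb ν H S X ops1 + meanImb ν H S Q ops1) := by
    rw [hc1, ha.meanImb_union hl1 hRXQ, ha.meanImb_union hl1 hXQ, mean1 subset_rfl]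
  have hτ3 : meanImb ν H S (curr ∅ (ops1 ++ d2 ++ i2)) (ops1 ++ d2 ++ i2) =
      meanImb ν H S R ops +
        (meanImb ν H S Q ops1 + meanImb ν H S Q' (ops1 ++ d2 ++ i2)) := by
    rw [hc3, ha.meanImb_union hl3 hRQQ, ha.meanImb_union hl3 hQQ',
      mean3 Finset.subset_union_left, mean3 Finset.subset_union_right, mean1 subset_rfl]
  refine ⟨ext, B', n + 2 * k, hextl, ?_, ?_, meanImb ν H S X ops1,
    meanImb ν H S (curr ∅ ops1) ops1, ?_, ?_, ?_, ?_⟩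
  · rw [hext']
    refine ⟨hl3, by rw [hc3, hf3], fun a => ?_, fun a b hab => ?_, fun a => ?_, fun x hx => ?_,
      by omega, ?_⟩
    · rw [hc3]
      rcases hB'3 a with ⟨_, h⟩ | ⟨_, h⟩ | ⟨_, _, h, h'⟩ <;> rw [h]
      · exact Finset.subset_union_right.trans Finset.subset_union_right
      · exact Finset.subset_union_left.trans Finset.subset_union_right
      · exact h'.trans Finset.subset_union_left
    · rcases hB'3 a with ⟨ea, h⟩ | ⟨ea, h⟩ | ⟨_, _, h, h'⟩ <;>
      rcases hB'3 b with ⟨eb, g⟩ | ⟨eb, g⟩ | ⟨_, _, g, g'⟩ <;> rw [h, g]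
      · exact absurd (ea.trans eb.symm) hab
      · exact hQQ'.symm
      · exact (hRQ'.mono_left g').symm
      · exact hQQ'
      · exact absurd (ea.trans eb.symm) hab
      · exact (hRQ.mono_left g').symm
      · exact hRQ'.mono_left h'
      · exact hRQ.mono_left h'
      · exact hc.disj a b hab
    · rw [← hk]
      rcases hB'3 a with ⟨_, h⟩ | ⟨_, h⟩ | ⟨_, _, h, _⟩ <;> rw [h]
      · exact hQc'
      · exact hQc
      · exact hcB a
    · rw [hc3] at hx
      rcases Finset.mem_union.1 hx with h | h
      · have := hc.lt x (hRP h); omega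
      rcases Finset.mem_union.1 h with h | h
      · have := hQm x h; omega
      · exact (hQm' x h).2
    · rw [hc3]
      exact Finset.disjoint_union_right.2 ⟨hXR, Finset.disjoint_union_right.2 ⟨hXQ, hXQ'⟩⟩
  · intro a h1 h2
    have hs := hBR a h1 h2
    rw [hext', hB'l a h1 h2, mean3 (hs.trans Finset.subset_union_left), mean1 hs]
  · refine ha.abs_meanImb_all_le hl1 ?_ ?_
    · rw [hc1, Finset.card_union_of_disjoint hRXQ, hXQc, hRc]
    · have := hno (d ++ i1) (by rw [← List.append_assoc]; exact hl1) ?_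
      · rwa [← List.append_assoc] at this
      · rw [← hextl, hext]; simp only [List.length_append]; omega
  · rw [hext', hB'j, mean3 Finset.subset_union_right, hτ1, hτ]; ring
  · rw [hext', hB'i, hτ3, hτ1]; ring
  · rw [hext', hB'j, mean3 Finset.subset_union_right]; exact hl

/-! ### The potential -/

/-- The sum of the squares of the mean imbalances of the blocks. -/
noncomputable def potential (ν : Measure Z) (H : Z → ℕ → BinPair) (S : Z → Strategy)
    {M : ℕ} (B : Fin M → Finset ℕ) (ops : List Op) : ℝ :=
  ∑ i, meanImb ν H S (B i) ops ^ 2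

/-- The gain in potential when two blocks are replaced. The means `u`, `v` of the two blocks lie in
a window `[a, a + 2 σ]`, and `x`, `y`, `u'` are those of `X`, of the fresh block inserted with it, and
of the block that replaces `X`; `τ`, `τ₁`, `τ'` are the total means. Subtracting `2 a τ` makes the
effect of the drift of `τ` a lower order term. -/
theorem replace_gain {u v x y u' τ τ₁ τ' a σ : ℝ} (hσ : 0 < σ)
    (hu : a ≤ u) (hu2 : u ≤ a + 2 * σ) (hv : a ≤ v) (hv2 : v ≤ a + 2 * σ)
    (hxy : x + y = u + v + (τ₁ - τ)) (hu' : u' = x + (τ' - τ₁)) (hgap : y + 4 * σ ≤ x)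
    (h0 : |τ| ≤ σ / 50) (h1 : |τ₁| ≤ σ / 50) (h2 : |τ'| ≤ σ / 50) :
    u ^ 2 + v ^ 2 - 2 * a * τ + 4 * σ ^ 2 ≤ u' ^ 2 + y ^ 2 - 2 * a * τ' := by
  rw [abs_le] at h0 h1 h2
  obtain ⟨p, rfl⟩ : ∃ p, u = a + p := ⟨u - a, by ring⟩
  obtain ⟨r, rfl⟩ : ∃ r, v = a + r := ⟨v - a, by ring⟩
  obtain ⟨D, hD⟩ : ∃ D, D = τ' - τ := ⟨_, rfl⟩
  obtain ⟨g, hg⟩ : ∃ g, g = u' - y := ⟨_, rfl⟩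
  have e1 : u' = a + (p + r + D + g) / 2 := by linarith
  have e2 : y = a + (p + r + D - g) / 2 := by linarith
  have hg' : 4 * σ - σ / 25 ≤ g := by linarith
  have hp : 0 ≤ p := by linarith
  have hr : 0 ≤ r := by linarith
  have key : u' ^ 2 + y ^ 2 - 2 * a * τ' - ((a + p) ^ 2 + (a + r) ^ 2 - 2 * a * τ) =
      (2 * (p + r) * D + D ^ 2 + g ^ 2 - (p - r) ^ 2) / 2 := by
    rw [e1, e2]
    have : τ' = τ + D := by linarith
    rw [this]; ring
  have b1 : (4 * σ - σ / 25) ^ 2 ≤ g ^ 2 := by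
    apply pow_le_pow_left₀ (by linarith) hg'
  have b2 : (p - r) ^ 2 ≤ (2 * σ) ^ 2 := by
    apply sq_le_sq'  <;> linarith
  have b3 : -(4 * σ * (σ / 25)) ≤ (p + r) * D := by
    have : (p + r) * (-(σ / 25)) ≤ (p + r) * D :=
      mul_le_mul_of_nonneg_left (by linarith) (by linarith)
    have : (p + r) * (σ / 25) ≤ 4 * σ * (σ / 25) :=
      mul_le_mul_of_nonneg_right (by linarith) (by linarith)
    linarith
  nlinarith [sq_nonneg D]

/-- Pairing up `2 t` blocks whose means lie in a window `[a, a + 2 s]`, and replacing each pair. -/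
theorem Arena.replace_many (ha : Arena ν H S m s δ X n₀) (a : ℝ) (t : ℕ) :
    ∀ {ops : List Op} {B : Fin (26 * s ^ 2) → Finset ℕ} {n : ℕ}, Config m s X n₀ ops B n →
    ∀ I : Finset (Fin (26 * s ^ 2)), 2 * t ≤ I.card →
    (∀ i ∈ I, a ≤ meanImb ν H S (B i) ops ∧ meanImb ν H S (B i) ops ≤ a + 2 * s) →
    (∀ ext, Legal m ∅ (ops ++ ext) → ext.length ≤ t * (6 * (12 * s ^ 2)) →
      ν.real {z | ReachesLoad (S z) (H z) (ops ++ ext) ((m : ℝ) / 4 + δ)} < 1 / m) →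
    ∃ ext B' n', ext.length = t * (6 * (12 * s ^ 2)) ∧ Config m s X n₀ (ops ++ ext) B' n' ∧
      potential ν H S B ops - 2 * a * meanImb ν H S (curr ∅ ops) ops + t * (4 * (s : ℝ) ^ 2) ≤
        potential ν H S B' (ops ++ ext) -
          2 * a * meanImb ν H S (curr ∅ (ops ++ ext)) (ops ++ ext) := by
  classical
  induction t with
  | zero =>
    intro ops B n hc I _ _ _
    exact ⟨[], B, n, by simp, by simpa using hc, by simp⟩
  | succ t ih =>
    intro ops B n hc I hI hwin hno
    obtain ⟨i, hi, j, hj, hij⟩ := Finset.one_lt_card.1 (by omega : 1 < I.card)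
    have hs0 : (0 : ℝ) < s := by exact_mod_cast ha.s_pos
    have hno1 : ∀ ext, Legal m ∅ (ops ++ ext) → ext.length ≤ 6 * (12 * s ^ 2) →
        ν.real {z | ReachesLoad (S z) (H z) (ops ++ ext) ((m : ℝ) / 4 + δ)} < 1 / m :=
      fun ext h1 h2 => hno ext h1 (h2.trans (Nat.le_mul_of_pos_left _ t.succ_pos))
    obtain ⟨ext, B1, n1, hlen, hc1, hother, x, τ₁, hτ₁, hxy, hx', hgap⟩ := ha.replace hc hij hno1
    have hτ0 := ha.abs_meanImb_all_le hc.legal hc.full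
      (by simpa using hno1 [] (by simpa using hc.legal) (by simp))
    have hτ' := ha.abs_meanImb_all_le hc1.legal hc1.full (hno1 ext hc1.legal hlen.le)
    have hgain := replace_gain hs0 (hwin i hi).1 (hwin i hi).2 (hwin j hj).1 (hwin j hj).2
      hxy hx' hgap hτ0 hτ₁ hτ'
    have hpot : potential ν H S B1 (ops ++ ext) - potential ν H S B ops =
        meanImb ν H S (B1 i) (ops ++ ext) ^ 2 + meanImb ν H S (B1 j) (ops ++ ext) ^ 2 -
        (meanImb ν H S (B i) ops ^ 2 + meanImb ν H S (B j) ops ^ 2) := by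
      unfold potential
      rw [← Finset.sum_sub_distrib,
        ← Finset.sum_subset (Finset.subset_univ ({i, j} : Finset (Fin (26 * s ^ 2))))]
      · rw [Finset.sum_pair hij]; ring
      · intro l _ hl
        simp only [Finset.mem_insert, Finset.mem_singleton, not_or] at hl
        rw [hother l hl.1 hl.2, sub_self]
    obtain ⟨ext2, B2, n2, hlen2, hc2, hfin⟩ := ih hc1 ((I.erase i).erase j) (by
        rw [Finset.card_erase_of_mem (Finset.mem_erase.2 ⟨hij.symm, hj⟩),
          Finset.card_erase_of_mem hi]; omega)
      (fun l hl => by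
        obtain ⟨h1, h2⟩ := Finset.mem_erase.1 hl
        obtain ⟨h3, h4⟩ := Finset.mem_erase.1 h2
        rw [hother l h3 h1]; exact hwin l h4)
      (fun e h1 h2 => by
        rw [List.append_assoc] at h1 ⊢
        exact hno _ h1 (by rw [List.length_append, hlen, add_mul, one_mul]; omega))
    refine ⟨ext ++ ext2, B2, n2, ?_, ?_, ?_⟩
    · rw [List.length_append, hlen, hlen2, add_mul, one_mul]; omega
    · rw [← List.append_assoc]; exact hc2
    · rw [← List.append_assoc]
      refine le_trans ?_ hfin
      push_cast
      linarith

/-- Many blocks have similar means, and replacing them in pairs raises the potential: the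
total drift of the imbalance costs less than what the replacements yield. -/
theorem Arena.batch (ha : Arena ν H S m s δ X n₀) {ops : List Op}
    {B : Fin (26 * s ^ 2) → Finset ℕ} {n : ℕ} (hc : Config m s X n₀ ops B n)
    (hno : ∀ ext, Legal m ∅ (ops ++ ext) → ext.length ≤ s * (6 * (12 * s ^ 2)) →
      ν.real {z | ReachesLoad (S z) (H z) (ops ++ ext) ((m : ℝ) / 4 + δ)} < 1 / m) :
    ∃ ext B' n', ext.length = s * (6 * (12 * s ^ 2)) ∧ Config m s X n₀ (ops ++ ext) B' n' ∧
      potential ν H S B ops + 3 * (s : ℝ) ^ 3 ≤ potential ν H S B' (ops ++ ext) := by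
  classical
  have hs0 : (0 : ℝ) < s := by exact_mod_cast ha.s_pos
  have hsn := ha.s_pos
  set e : Fin (26 * s ^ 2) → ℝ := fun i => meanImb ν H S (B i) ops with he
  have hebound : ∀ i, |e i| ≤ 12 * (s : ℝ) ^ 2 := by
    intro i
    have := abs_meanImb_le (ν := ν) (H := H) (S := S) hc.legal (B i)
    rw [hc.card_block i] at this
    exact_mod_cast this
  -- the index of the window of width `2 s` that contains the mean
  let c : Fin (26 * s ^ 2) → ℕ := fun i => ⌊(e i + 12 * (s : ℝ) ^ 2) / (2 * s)⌋₊
  have hnonneg : ∀ i, 0 ≤ (e i + 12 * (s : ℝ) ^ 2) / (2 * s) := fun i =>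
    div_nonneg (by linarith [(abs_le.1 (hebound i)).1]) (by linarith)
  have hc12 : ∀ i, c i ≤ 12 * s := by
    intro i
    apply Nat.floor_le_of_le
    rw [div_le_iff₀ (by linarith)]
    push_cast
    nlinarith [(abs_le.1 (hebound i)).2]
  have hmaps : ∀ i ∈ (Finset.univ : Finset (Fin (26 * s ^ 2))),
      c i ∈ Finset.range (12 * s + 1) := fun i _ =>
    Finset.mem_range.2 (Nat.lt_succ_of_le (hc12 i))
  obtain ⟨y, hy, hcard⟩ := Finset.exists_le_card_fiber_of_mul_le_card_of_maps_to (n := 2 * s)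
    hmaps ⟨0, by simp⟩ (by
      rw [Finset.card_range, Finset.card_univ, Fintype.card_fin]
      nlinarith)
  have hy12 : y ≤ 12 * s := Nat.lt_succ_iff.1 (Finset.mem_range.1 hy)
  set a : ℝ := 2 * s * y - 12 * (s : ℝ) ^ 2 with haa
  have hyr : (y : ℝ) ≤ 12 * s := by exact_mod_cast hy12
  have hy0 : (0 : ℝ) ≤ y := Nat.cast_nonneg y
  have ha_abs : |a| ≤ 12 * (s : ℝ) ^ 2 := by
    rw [abs_le]; constructor <;> nlinarith
  obtain ⟨ext, B', n', hlen, hc', hgain⟩ := ha.replace_many a s hc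
    (Finset.univ.filter fun i => c i = y) hcard (fun i hi => by
      have hci : c i = y := (Finset.mem_filter.1 hi).2
      have h1 := Nat.floor_le (hnonneg i)
      have h2 := Nat.lt_floor_add_one ((e i + 12 * (s : ℝ) ^ 2) / (2 * s))
      have hci' : ⌊(e i + 12 * (s : ℝ) ^ 2) / (2 * s)⌋₊ = y := hci
      rw [hci'] at h1 h2
      rw [le_div_iff₀ (by linarith)] at h1
      rw [div_lt_iff₀ (by linarith)] at h2
      constructor <;> simp only [he] at h1 h2 <;> rw [haa] <;> nlinarith) hno
  refine ⟨ext, B', n', hlen, hc', ?_⟩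
  have hτ0 := abs_le.1 (ha.abs_meanImb_all_le hc.legal hc.full
      (by simpa using hno [] (by simpa using hc.legal) (by simp)))
  have hτ' := abs_le.1 (ha.abs_meanImb_all_le hc'.legal hc'.full (hno ext hc'.legal hlen.le))
  set τ0 := meanImb ν H S (curr ∅ ops) ops
  set τ' := meanImb ν H S (curr ∅ (ops ++ ext)) (ops ++ ext)
  have hdrift : -(12 * (s : ℝ) ^ 2 * (s / 25)) ≤ a * (τ' - τ0) := by
    have h1 : |a * (τ' - τ0)| ≤ 12 * (s : ℝ) ^ 2 * (s / 25) := by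
      rw [abs_mul]
      refine mul_le_mul ha_abs ?_ (abs_nonneg _) (by positivity)
      rw [abs_le]; constructor <;> linarith
    exact (abs_le.1 h1).1
  have h3 : (0 : ℝ) < (s : ℝ) ^ 3 := by positivity
  have e3 : 12 * (s : ℝ) ^ 2 * (s / 25) = 12 / 25 * (s : ℝ) ^ 3 := by ring
  have e4 : (s : ℝ) * (4 * (s : ℝ) ^ 2) = 4 * (s : ℝ) ^ 3 := by ring
  rw [e3] at hdrift
  rw [e4] at hgain
  linarith

theorem Arena.batches (ha : Arena ν H S m s δ X n₀) (t : ℕ) :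
    ∀ {ops : List Op} {B : Fin (26 * s ^ 2) → Finset ℕ} {n : ℕ}, Config m s X n₀ ops B n →
    (∀ ext, Legal m ∅ (ops ++ ext) → ext.length ≤ t * (s * (6 * (12 * s ^ 2))) →
      ν.real {z | ReachesLoad (S z) (H z) (ops ++ ext) ((m : ℝ) / 4 + δ)} < 1 / m) →
    ∃ ext B' n', Config m s X n₀ (ops ++ ext) B' n' ∧
      potential ν H S B ops + t * (3 * (s : ℝ) ^ 3) ≤ potential ν H S B' (ops ++ ext) := by
  induction t with
  | zero =>
    intro ops B n hc _
    exact ⟨[], B, n, by simpa using hc, by simp⟩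
  | succ t ih =>
    intro ops B n hc hno
    obtain ⟨ext, B1, n1, hlen, hc1, hpot⟩ := ha.batch hc
      (fun ext h1 h2 => hno ext h1 (h2.trans (Nat.le_mul_of_pos_left _ t.succ_pos)))
    obtain ⟨ext2, B2, n2, hc2, hpot2⟩ := ih hc1 (fun e h1 h2 => by
      rw [List.append_assoc] at h1 ⊢
      exact hno _ h1 (by rw [List.length_append, hlen, add_mul, one_mul]; omega))
    refine ⟨ext ++ ext2, B2, n2, ?_, ?_⟩
    · rw [← List.append_assoc]; exact hc2
    · rw [← List.append_assoc]
      push_cast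
      linarith

theorem card_curr_le (m : ℕ) (P : Finset ℕ) (ops : List Op) (hP : P.card ≤ m)
    (hl : Legal m P ops) : (curr P ops).card ≤ m := by
  induction ops generalizing P with
  | nil => exact hP
  | cons o ops ih =>
    cases o with
    | insert x => exact ih _ ((Finset.card_insert_le _ _).trans hl.2.1) hl.2.2
    | delete x => exact ih _ ((Finset.card_erase_le).trans hP) hl.2

theorem exists_config (hs : 26 * s ^ 2 * (12 * s ^ 2) ≤ m) (hX : ∀ x ∈ X, x < n₀)
    {pre : List Op} (hl : Legal m ∅ pre) (he : curr ∅ pre = ∅) :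
    ∃ ext B n, ext.length = m ∧ Config m s X n₀ (pre ++ ext) B n := by
  classical
  obtain ⟨k, hk⟩ : ∃ k, k = 12 * s ^ 2 := ⟨_, rfl⟩
  rw [← hk] at hs
  have hc : curr ∅ (pre ++ (Finset.Ico n₀ (n₀ + m)).toList.map Op.insert) =
      Finset.Ico n₀ (n₀ + m) := by
    rw [curr_append, he, curr_inserts, Finset.toList_toFinset, Finset.empty_union]
  refine ⟨(Finset.Ico n₀ (n₀ + m)).toList.map Op.insert,
    fun i => Finset.Ico (n₀ + i * k) (n₀ + (i + 1) * k), n₀ + m, by simp, ?_, ?_, ?_, ?_, ?_, ?_,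
    by omega, ?_⟩
  · rw [legal_append, he]
    exact ⟨hl, legal_inserts _ _ _ (Finset.nodup_toList _) (by simp) (by simp)⟩
  · rw [hc, Nat.card_Ico]; omega
  · intro i x hx
    rw [hc, Finset.mem_Ico]
    rw [Finset.mem_Ico] at hx
    have h1 : ((i : ℕ) + 1) * k ≤ 26 * s ^ 2 * k := Nat.mul_le_mul_right _ i.2
    omega
  · intro i j hij
    rw [Finset.disjoint_left]
    intro x hx hx'
    rw [Finset.mem_Ico] at hx hx'
    rcases lt_or_gt_of_ne (Fin.val_ne_of_ne hij) with h | h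
    · have h1 : ((i : ℕ) + 1) * k ≤ j * k := Nat.mul_le_mul_right _ h
      omega
    · have h1 : ((j : ℕ) + 1) * k ≤ i * k := Nat.mul_le_mul_right _ h
      omega
  · intro i
    rw [Nat.card_Ico, ← hk, add_mul]; omega
  · intro x hx
    rw [hc, Finset.mem_Ico] at hx
    exact hx.2
  · rw [hc, Finset.disjoint_left]
    intro x hx hx'
    rw [Finset.mem_Ico] at hx'
    have := hX x hx
    omega

/-- The potential cannot grow for ever, so the adversary provokes an overload with
probability at least `1 / m`. Afterwards it empties the system. -/
theorem Arena.exists_overload (ha : Arena ν H S m s δ X n₀) {pre : List Op} (hl : Legal m ∅ pre)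
    (he : curr ∅ pre = ∅) :
    ∃ ext, ext.length ≤ 2 * m + 89928 * s ^ 6 ∧ Legal m ∅ (pre ++ ext) ∧
      curr ∅ (pre ++ ext) = ∅ ∧
      1 / m ≤ ν.real {z | ReachesLoad (S z) (H z) (pre ++ ext) ((m : ℝ) / 4 + δ)} := by
  classical
  have hs0 : (0 : ℝ) < s := by exact_mod_cast ha.s_pos
  suffices ∃ ext, ext.length ≤ m + 89928 * s ^ 6 ∧ Legal m ∅ (pre ++ ext) ∧
      1 / m ≤ ν.real {z | ReachesLoad (S z) (H z) (pre ++ ext) ((m : ℝ) / 4 + δ)} by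
    obtain ⟨ext, h1, h2, h3⟩ := this
    have hcard := card_curr_le m ∅ _ (by simp) h2
    refine ⟨ext ++ (curr ∅ (pre ++ ext)).toList.map Op.delete, ?_, ?_, ?_, ?_⟩
    · rw [List.length_append, List.length_map, Finset.length_toList]; omega
    · rw [← List.append_assoc, legal_append]
      exact ⟨h2, legal_deletes _ _ _ (Finset.nodup_toList _) (fun x hx => Finset.mem_toList.1 hx)⟩
    · rw [← List.append_assoc, curr_append, curr_deletes, Finset.toList_toFinset,
        Finset.sdiff_self]
    · refine h3.trans (measureReal_mono fun z hz => ?_)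
      rw [← List.append_assoc]
      exact ReachesLoad.append hz _
  by_contra hcon
  push Not at hcon
  obtain ⟨ext₀, B, n, hlen₀, hc⟩ := exists_config ha.le_m ha.X_lt hl he
  -- `1249 s ^ 3` batches of gain `3 s ^ 3` exceed the bound `26 s ^ 2 * (12 s ^ 2) ^ 2`
  obtain ⟨ext, B', n', hc', hpot⟩ := ha.batches (1249 * s ^ 3) hc (fun e h1 h2 => by
    rw [List.append_assoc] at h1 ⊢
    refine hcon _ ?_ h1
    rw [List.length_append, hlen₀]
    have : 1249 * s ^ 3 * (s * (6 * (12 * s ^ 2))) = 89928 * s ^ 6 := by ring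
    omega)
  have hle : potential ν H S B' (pre ++ ext₀ ++ ext) ≤ 3744 * (s : ℝ) ^ 6 := by
    unfold potential
    refine (Finset.sum_le_card_nsmul _ _ ((12 * (s : ℝ) ^ 2) ^ 2) fun i _ => ?_).trans ?_
    · have := abs_meanImb_le (ν := ν) (H := H) (S := S) hc'.legal (B' i)
      rw [hc'.card_block i] at this
      rw [← sq_abs]
      refine pow_le_pow_left₀ (abs_nonneg _) ?_ 2
      exact_mod_cast this
    · rw [Finset.card_univ, Fintype.card_fin, nsmul_eq_mul]
      push_cast
      exact le_of_eq (by ring)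
  have h0 : 0 ≤ potential ν H S B (pre ++ ext₀) := Finset.sum_nonneg fun i _ => sq_nonneg _
  have h6 : (0 : ℝ) < (s : ℝ) ^ 6 := by positivity
  have e : ((1249 * s ^ 3 : ℕ) : ℝ) * (3 * (s : ℝ) ^ 3) = 3747 * (s : ℝ) ^ 6 := by
    push_cast; ring
  rw [e] at hpot
  linarith

end

section

open ProbabilityTheory

/-! ### Independence of the hashes -/

instance instProbHash : IsProbabilityMeasure hashMeasure := by
  unfold hashMeasure; infer_instance

theorem iIndepFun_hash : iIndepFun (fun (x : ℕ) (h : ℕ → BinPair) => h x) hashMeasure :=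
  iIndepFun_infinitePi (X := fun _ p => p) (fun _ => measurable_id)

theorem uniform_singleton (p : BinPair) :
    (PMF.uniformOfFintype BinPair).toMeasure {p} = (12 : ENNReal)⁻¹ := by
  rw [PMF.toMeasure_apply_singleton _ _ (measurableSet_singleton p), PMF.uniformOfFintype_apply,
    card_binPair]
  rfl

/-- A set of hash functions is determined by the hashes of the balls in `U`. -/
def DeterminedBy (U : Finset ℕ) (T : Set (ℕ → BinPair)) : Prop :=
  ∀ h h' : ℕ → BinPair, (∀ x ∈ U, h x = h' x) → (h ∈ T ↔ h' ∈ T)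

theorem DeterminedBy.exists_preimage {U : Finset ℕ} {T : Set (ℕ → BinPair)}
    (hT : DeterminedBy U T) :
    ∃ T' : Set (U → BinPair), T = (fun h (i : U) => h i) ⁻¹' T' := by
  classical
  refine ⟨{y | (fun x => if hx : x ∈ U then y ⟨x, hx⟩ else Classical.arbitrary _) ∈ T}, ?_⟩
  ext h
  refine hT _ _ fun x hx => ?_
  simp [hx]

theorem DeterminedBy.measurableSet {U : Finset ℕ} {T : Set (ℕ → BinPair)}
    (hT : DeterminedBy U T) : MeasurableSet T := by
  obtain ⟨T', rfl⟩ := hT.exists_preimage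
  exact (measurable_pi_lambda _ fun i => measurable_pi_apply _) (Set.toFinite T').measurableSet

theorem hashMeasure_inter {U A : Finset ℕ} {F T : Set (ℕ → BinPair)} (hUA : Disjoint U A)
    (hF : DeterminedBy U F) (hT : DeterminedBy A T) :
    hashMeasure (F ∩ T) = hashMeasure F * hashMeasure T := by
  obtain ⟨F', rfl⟩ := hF.exists_preimage
  obtain ⟨T', rfl⟩ := hT.exists_preimage
  exact (iIndepFun_hash.indepFun_finset U A hUA
    (fun i => measurable_pi_apply i)).measure_inter_preimage_eq_mul _ _
    (Set.toFinite F').measurableSet (Set.toFinite T').measurableSet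

/-- An event that depends on the hashes of `U` and on the random bits of the strategy is independent
of the hashes of other balls. -/
theorem prod_inter {Ω : Type*} [MeasurableSpace Ω] (P : Measure Ω) [IsProbabilityMeasure P]
    {U A : Finset ℕ} (hUA : Disjoint U A) {F : Set ((ℕ → BinPair) × Ω)} (hFm : MeasurableSet F)
    (hF : ∀ ω, DeterminedBy U {h | (h, ω) ∈ F}) {T : Set (ℕ → BinPair)} (hT : DeterminedBy A T) :
    (hashMeasure.prod P) (F ∩ Prod.fst ⁻¹' T) = (hashMeasure.prod P) F * hashMeasure T := by
  rw [Measure.prod_apply_symm (hFm.inter (measurable_fst hT.measurableSet)),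
    Measure.prod_apply_symm hFm, ← lintegral_mul_const _ (measurable_measure_prodMk_right hFm)]
  exact lintegral_congr fun ω => hashMeasure_inter hUA (hF ω) hT

theorem cnt_congr {h h' : ℕ → BinPair} {A : Finset ℕ} (hh : ∀ x ∈ A, h x = h' x) (p : BinPair) :
    cnt h p A = cnt h' p A := by
  unfold cnt
  congr 1
  exact Finset.filter_congr fun x hx => by rw [hh x hx]

theorem measurable_cnt (p : BinPair) (A : Finset ℕ) :
    Measurable fun h : ℕ → BinPair => cnt h p A := by
  refine measurable_to_countable' fun v => ?_
  exact DeterminedBy.measurableSet (U := A) fun h h' hh => by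
    simp only [Set.mem_preimage, Set.mem_singleton_iff]
    rw [cnt_congr hh]

/-! ### The number of balls with a given hash -/

theorem cnt_eq_sum (p : BinPair) (A : Finset ℕ) :
    (fun h : ℕ → BinPair => (cnt h p A : ℝ)) =
      ∑ x ∈ A, fun h : ℕ → BinPair => if h x = p then (1 : ℝ) else 0 := by
  funext h; simp [cnt]

theorem integral_indicator_hash (p : BinPair) (x : ℕ) :
    ∫ h, (if h x = p then (1 : ℝ) else 0) ∂hashMeasure = 1 / 12 := by
  have e : (fun h : ℕ → BinPair => if h x = p then (1 : ℝ) else 0) =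
      ((fun h : ℕ → BinPair => h x) ⁻¹' {p}).indicator 1 := by
    funext h
    by_cases hx : h x = p
    · have hm : h ∈ (fun h : ℕ → BinPair => h x) ⁻¹' {p} := hx
      rw [if_pos hx, Set.indicator_of_mem hm, Pi.one_apply]
    · have hm : h ∉ (fun h : ℕ → BinPair => h x) ⁻¹' {p} := hx
      rw [if_neg hx, Set.indicator_of_notMem hm]
  rw [e, integral_indicator_one ((measurable_pi_apply x) (measurableSet_singleton p))]
  have := (measurePreserving_eval_infinitePi
    (fun _ : ℕ => (PMF.uniformOfFintype BinPair).toMeasure) x).measure_preimage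
    (measurableSet_singleton p).nullMeasurableSet
  rw [uniform_singleton] at this
  rw [Measure.real, show hashMeasure ((fun h : ℕ → BinPair => h x) ⁻¹' {p}) = _ from this]
  simp

theorem memLp_indicator_hash (p : BinPair) (x : ℕ) :
    MemLp (fun h : ℕ → BinPair => if h x = p then (1 : ℝ) else 0) 2 hashMeasure := by
  refine MemLp.of_bound (C := 1) ?_ ?_
  · exact ((measurable_of_countable (fun c : BinPair => if c = p then (1 : ℝ) else 0)).comp
      (measurable_pi_apply x)).aestronglyMeasurable
  · refine Filter.Eventually.of_forall fun h => ?_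
    split_ifs <;> simp

theorem integral_abs_cnt_le (p : BinPair) (A : Finset ℕ) {s : ℕ} (hs : 0 < s)
    (hA : A.card = 12 * s ^ 2) :
    ∫ h, |(cnt h p A : ℝ) - (s : ℝ) ^ 2| ∂hashMeasure ≤ s := by
  have hs0 : (0 : ℝ) < s := by exact_mod_cast hs
  have hLp : MemLp (fun h : ℕ → BinPair => (cnt h p A : ℝ)) 2 hashMeasure := by
    rw [cnt_eq_sum]; exact memLp_finsetSum' _ fun x _ => memLp_indicator_hash p x
  have hmean : ∫ h, (cnt h p A : ℝ) ∂hashMeasure = (s : ℝ) ^ 2 := by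
    have : ∀ h : ℕ → BinPair, (cnt h p A : ℝ) = ∑ x ∈ A, if h x = p then (1 : ℝ) else 0 := by
      intro h; simp [cnt]
    simp_rw [this]
    rw [integral_finsetSum _ fun x _ => (memLp_indicator_hash p x).integrable (by norm_num)]
    simp_rw [integral_indicator_hash]
    rw [Finset.sum_const, hA, nsmul_eq_mul]; push_cast; ring
  have hvar : ∫ h, ((cnt h p A : ℝ) - (s : ℝ) ^ 2) ^ 2 ∂hashMeasure ≤ (s : ℝ) ^ 2 := by
    rw [← hmean, ← variance_eq_integral hLp.aestronglyMeasurable.aemeasurable, cnt_eq_sum,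
      IndepFun.variance_sum (fun x _ => memLp_indicator_hash p x)
        (fun x _ y _ hxy => (iIndepFun_hash.indepFun hxy).comp
          (measurable_of_countable (fun c : BinPair => if c = p then (1 : ℝ) else 0))
          (measurable_of_countable (fun c : BinPair => if c = p then (1 : ℝ) else 0)))]
    refine (Finset.sum_le_card_nsmul _ _ (1 / 12 : ℝ) fun x _ => ?_).trans ?_
    · refine (variance_le_expectation_sq (memLp_indicator_hash p x).aestronglyMeasurable).trans ?_
      rw [← integral_indicator_hash p x]
      refine le_of_eq (integral_congr_ae (Filter.Eventually.of_forall fun h => ?_))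
      simp only [Pi.pow_apply]
      split_ifs <;> simp
    · rw [hA, ← cnt_eq_sum, hmean, nsmul_eq_mul]; push_cast; linarith
  have hLp2 : MemLp (fun h : ℕ → BinPair => (cnt h p A : ℝ) - (s : ℝ) ^ 2) 2 hashMeasure :=
    hLp.sub (memLp_const _)
  -- `|t| ≤ t ^ 2 / (2 s) + s / 2` reduces the mean deviation to the variance
  calc ∫ h, |(cnt h p A : ℝ) - (s : ℝ) ^ 2| ∂hashMeasure
      ≤ ∫ h, (((cnt h p A : ℝ) - (s : ℝ) ^ 2) ^ 2 / (2 * s) + s / 2) ∂hashMeasure := by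
        refine integral_mono (hLp2.integrable (by norm_num)).abs
          ((hLp2.integrable_sq.div_const _).add (integrable_const _)) fun h => ?_
        rw [div_add_div _ _ (by positivity) (by norm_num), le_div_iff₀ (by positivity)]
        have := sq_nonneg (|(cnt h p A : ℝ) - (s : ℝ) ^ 2| - s)
        rw [sub_sq, sq_abs] at this
        linarith
    _ = (∫ h, ((cnt h p A : ℝ) - (s : ℝ) ^ 2) ^ 2 ∂hashMeasure) / (2 * s) + s / 2 := by
        rw [integral_add (hLp2.integrable_sq.div_const _) (integrable_const _),
          integral_div]
        simp
    _ ≤ (s : ℝ) ^ 2 / (2 * s) + s / 2 := by gcongr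
    _ = s := by field_simp; ring

/-! ### The probability of a prescribed surplus -/

/-- The event that `X` contains exactly `s ^ 2 + 4 s * bias p` balls with hash `p`, for all `p`. -/
def surplus (X : Finset ℕ) (s : ℕ) : Set (ℕ → BinPair) :=
  {h | ∀ p, (cnt h p X : ℝ) = (s : ℝ) ^ 2 + 4 * s * bias p}

theorem surplus_determinedBy (X : Finset ℕ) (s : ℕ) : DeterminedBy X (surplus X s) := by
  intro h h' hh
  simp only [surplus, Set.mem_ofPred_eq]
  simp_rw [cnt_congr hh]

theorem hashMeasure_restrict (X : Finset ℕ) (F : Finset (X → BinPair)) :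
    hashMeasure ((fun h (i : X) => h i) ⁻¹' (F : Set (X → BinPair))) =
      F.card * ((12 : ENNReal)⁻¹) ^ X.card := by
  have h1 := Measure.infinitePi_map_restrict
    (fun _ : ℕ => (PMF.uniformOfFintype BinPair).toMeasure) (I := X)
  have h2 : hashMeasure ((fun h (i : X) => h i) ⁻¹' (F : Set (X → BinPair))) =
      (Measure.infinitePi fun _ : ℕ => (PMF.uniformOfFintype BinPair).toMeasure).map
        X.restrict (F : Set (X → BinPair)) := by
    rw [Measure.map_apply (Finset.measurable_restrict X) (Finset.measurableSet F)]
    rfl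
  rw [h2, h1, ← sum_measure_singleton]
  rw [Finset.sum_congr rfl (g := fun _ => ((12 : ENNReal)⁻¹) ^ X.card)]
  · simp
  · intro f _
    rw [Measure.pi_singleton]
    simp only [uniform_singleton, Finset.prod_const, Finset.card_univ, Fintype.card_coe]

/-- Permuting `α` turns `f` into a multinomial number of functions with the same fiber sizes. -/
theorem factorial_le_card_fibers (α : Type*) [Fintype α] [DecidableEq α] (f : α → BinPair) :
    ∃ F : Finset (α → BinPair),
      (∀ g ∈ F, ∀ p, (Finset.univ.filter fun a => g a = p).card =
        (Finset.univ.filter fun a => f a = p).card) ∧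
      (Fintype.card α).factorial ≤
        (∏ p, (Finset.univ.filter fun a => f a = p).card.factorial) * F.card := by
  classical
  refine ⟨Finset.univ.image fun σ : Equiv.Perm α => f ∘ σ, ?_, ?_⟩
  · intro g hg p
    obtain ⟨σ, _, rfl⟩ := Finset.mem_image.1 hg
    refine Finset.card_bij' (fun a _ => σ a) (fun a _ => σ.symm a) ?_ ?_ ?_ ?_ <;>
      intro a ha <;> simp_all
  · rw [← Fintype.card_perm, ← Finset.card_univ]
    refine Finset.card_le_mul_card_image _ _ fun g hg => ?_
    obtain ⟨σ, _, rfl⟩ := Finset.mem_image.1 hg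
    have := DomMulAct.stabilizer_card f
    simp only [Fintype.card_subtype] at this
    rw [← this]
    refine Finset.card_le_card_of_injOn (fun τ => τ * σ⁻¹) (fun τ hτ => ?_)
      (fun a _ b _ hab => mul_right_cancel hab)
    have h2 : f ∘ τ = f ∘ σ := by simpa using hτ
    simp only [Finset.coe_filter, Finset.mem_univ, true_and, Set.mem_ofPred_eq]
    funext a
    have := congrFun h2 (σ⁻¹ a)
    simpa using this

theorem exists_hash_with_fibers (α : Type*) [Fintype α] [DecidableEq α] (c : BinPair → ℕ)
    (hc : ∑ p, c p = Fintype.card α) :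
    ∃ f : α → BinPair, ∀ p, (Finset.univ.filter fun a => f a = p).card = c p := by
  classical
  have e : α ≃ (p : BinPair) × Fin (c p) := Fintype.equivOfCardEq (by simp [hc])
  refine ⟨fun a => (e a).1, fun p => ?_⟩
  rw [← Fintype.card_fin (c p), ← Finset.card_univ]
  refine Finset.card_bij' (fun a ha => (Finset.mem_filter.1 ha).2 ▸ (e a).2)
    (fun i _ => e.symm ⟨p, i⟩) ?_ ?_ ?_ ?_
  · simp
  · simp
  · intro a ha
    obtain ⟨_, rfl⟩ := Finset.mem_filter.1 ha
    simp
  · intro i _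
    have : ∀ (y : (p : BinPair) × Fin (c p)) (hy : y = ⟨p, i⟩) (h : y.1 = p), h ▸ y.2 = i := by
      rintro y rfl h; rfl
    exact this _ (e.apply_symm_apply _) _

/-- The central multinomial coefficient is at least `12 ^ (12 q)`, up to a polynomial factor. -/
theorem factorial_pow_le (q : ℕ) (hq : 1 ≤ q) :
    q.factorial ^ 12 * 12 ^ (12 * q) ≤ 12 ^ 12 * q ^ 12 * (12 * q).factorial := by
  induction q, hq using Nat.le_induction with
  | base => simp; exact Nat.le_of_ble_eq_true rfl
  | succ q hq ih =>
    have h1 : (12 * q).factorial * (12 * q) ^ 12 ≤ (12 * (q + 1)).factorial := by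
      refine le_trans ?_ (Nat.factorial_mul_pow_le_factorial (m := 12 * q) (n := 12))
      gcongr
      omega
    calc (q + 1).factorial ^ 12 * 12 ^ (12 * (q + 1))
        = (q.factorial ^ 12 * 12 ^ (12 * q)) * (12 * (q + 1)) ^ 12 := by
          rw [Nat.factorial_succ, mul_add, pow_add]; ring
      _ ≤ (12 ^ 12 * q ^ 12 * (12 * q).factorial) * (12 * (q + 1)) ^ 12 :=
          Nat.mul_le_mul_right _ ih
      _ = 12 ^ 12 * (q + 1) ^ 12 * ((12 * q).factorial * (12 * q) ^ 12) := by ring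
      _ ≤ 12 ^ 12 * (q + 1) ^ 12 * (12 * (q + 1)).factorial := Nat.mul_le_mul_left _ h1

/-- Shifting two equal fibers apart by `8 s` changes the product of their factorials by a bounded
factor only. -/
theorem factorial_shift_le (s : ℕ) (hs : 8 ≤ s) :
    (((s ^ 2 + 4 * s).factorial : ℝ)) * (s ^ 2 - 4 * s).factorial ≤
      Real.exp 64 * ((s ^ 2).factorial : ℝ) ^ 2 := by
  have hle : 4 * s ≤ s ^ 2 := by nlinarith
  set q := s ^ 2 with hq
  set a := 4 * s with ha
  have h1 : (q + a).factorial ≤ q.factorial * (q + a) ^ a := by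
    rw [← Nat.factorial_mul_ascFactorial]
    exact Nat.mul_le_mul_left _ (Nat.ascFactorial_le_pow_add _ _)
  have h2 : (q - a).factorial * (q - a) ^ a ≤ q.factorial := by
    have := Nat.factorial_mul_pow_sub_le_factorial (Nat.sub_le q a)
    rwa [Nat.sub_sub_self hle] at this
  have hsr : (8 : ℝ) ≤ s := by exact_mod_cast hs
  have hqr : (q : ℝ) = (s : ℝ) ^ 2 := by rw [hq]; push_cast; ring
  have har : (a : ℝ) = 4 * s := by rw [ha]; push_cast; ring
  have hsub : ((q - a : ℕ) : ℝ) = (s : ℝ) ^ 2 - 4 * s := by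
    rw [Nat.cast_sub hle, hqr, har]
  have hpos : (0 : ℝ) < ((q - a : ℕ) : ℝ) := by rw [hsub]; nlinarith
  have h3 : ((q + a : ℕ) : ℝ) ^ a ≤ Real.exp 64 * ((q - a : ℕ) : ℝ) ^ a := by
    -- `(q + a) / (q - a) = 1 + 8 / (s - 4)`, which is at most `1 + 16 / s` as `8 ≤ s`
    have h4 : ((q + a : ℕ) : ℝ) ≤ Real.exp (16 / s) * ((q - a : ℕ) : ℝ) := by
      have h5 := Real.add_one_le_exp (16 / (s : ℝ))
      refine le_trans ?_ (mul_le_mul_of_nonneg_right h5 hpos.le)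
      rw [hsub]
      push_cast
      rw [hqr, har]
      have : (16 / (s : ℝ) + 1) * ((s : ℝ) ^ 2 - 4 * s) = s ^ 2 + 12 * s - 64 := by
        field_simp; ring
      rw [this]; linarith
    calc ((q + a : ℕ) : ℝ) ^ a ≤ (Real.exp (16 / s) * ((q - a : ℕ) : ℝ)) ^ a :=
          pow_le_pow_left₀ (Nat.cast_nonneg _) h4 a
      _ = Real.exp 64 * ((q - a : ℕ) : ℝ) ^ a := by
          rw [mul_pow, ← Real.exp_nat_mul, har]
          congr 2
          field_simp; norm_num
  calc ((q + a).factorial : ℝ) * (q - a).factorial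
      ≤ (q.factorial * ((q + a : ℕ) : ℝ) ^ a) * (q - a).factorial := by
        gcongr; exact_mod_cast h1
    _ ≤ (q.factorial * (Real.exp 64 * ((q - a : ℕ) : ℝ) ^ a)) * (q - a).factorial := by gcongr
    _ = Real.exp 64 * q.factorial * ((q - a).factorial * ((q - a : ℕ) : ℝ) ^ a) := by ring
    _ ≤ Real.exp 64 * q.factorial * q.factorial := by
        gcongr; exact_mod_cast h2
    _ = Real.exp 64 * (q.factorial : ℝ) ^ 2 := by ring

/-- The surplus has a probability that is polynomial in the number of balls. -/
theorem surplus_prob (X : Finset ℕ) {s : ℕ} (hs : 8 ≤ s) (hX : X.card = 12 * s ^ 2) :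
    1 / (Real.exp 128 * 12 ^ 12 * (s : ℝ) ^ 24) ≤ hashMeasure.real (surplus X s) := by
  classical
  have hle : 4 * s ≤ s ^ 2 := by nlinarith
  let c : BinPair → ℕ := fun p =>
    if bias p = 1 then s ^ 2 + 4 * s else if bias p = -1 then s ^ 2 - 4 * s else s ^ 2
  have hb : ∀ p, bias p = 1 ∨ bias p = -1 ∨ bias p = 0 := by decide
  have hcr : ∀ p, (c p : ℝ) = (s : ℝ) ^ 2 + 4 * s * bias p := by
    intro p
    simp only [c]
    rcases hb p with h | h | h <;> rw [h] <;> norm_num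
    rw [Nat.cast_sub hle]; push_cast; ring
  have hsum : ∑ p, c p = Fintype.card X := by
    rw [Fintype.card_coe, hX]
    have : ((∑ p, c p : ℕ) : ℝ) = ((12 * s ^ 2 : ℕ) : ℝ) := by
      push_cast
      simp_rw [hcr]
      rw [Finset.sum_add_distrib, ← Finset.mul_sum, ← Int.cast_sum, sum_bias, Finset.sum_const,
        Finset.card_univ, card_binPair]
      simp
    exact_mod_cast this
  obtain ⟨f, hf⟩ := exists_hash_with_fibers X c hsum
  obtain ⟨F, hF1, hF2⟩ := factorial_le_card_fibers X f
  simp_rw [hf] at hF1 hF2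
  have hsub : (fun h (i : X) => h i) ⁻¹' (F : Set (X → BinPair)) ⊆ surplus X s := by
    intro h hh p
    rw [← hcr p, ← hF1 _ hh p, cnt]
    norm_cast
    rw [← Finset.card_map (Function.Embedding.subtype fun x => x ∈ X)]
    congr 1
    ext x; simp [and_comm]
  have hmeas := measureReal_mono (μ := hashMeasure) hsub
  refine le_trans ?_ hmeas
  rw [Measure.real, hashMeasure_restrict]
  rw [Fintype.card_coe, hX] at hF2
  rw [hX]
  simp only [ENNReal.toReal_mul, ENNReal.toReal_pow, ENNReal.toReal_inv, ENNReal.toReal_natCast,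
    ENNReal.toReal_ofNat]
  have hprod : (∏ p, ((c p).factorial : ℝ)) ≤ Real.exp 128 * ((s ^ 2).factorial : ℝ) ^ 12 := by
    have e : ∀ g : ℤ → ℝ, ∏ p : BinPair, g (bias p) = (g 1 * g (-1)) ^ 2 * g 0 ^ 8 := by
      intro g
      rw [← Finset.prod_fiberwise_of_maps_to (s := Finset.univ) (t := {1, -1, 0}) (g := bias)
        (fun p _ => by rcases hb p with h | h | h <;> rw [h] <;> simp)]
      have hc1 : (Finset.univ.filter fun p : BinPair => bias p = 1).card = 2 := by decide
      have hc2 : (Finset.univ.filter fun p : BinPair => bias p = -1).card = 2 := by decide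
      have hc3 : (Finset.univ.filter fun p : BinPair => bias p = 0).card = 8 := by decide
      have hcon : ∀ v, ∏ p ∈ Finset.univ.filter (fun p : BinPair => bias p = v), g (bias p) =
          g v ^ (Finset.univ.filter fun p : BinPair => bias p = v).card := by
        intro v
        rw [← Finset.prod_const]
        exact Finset.prod_congr rfl fun p hp => by rw [(Finset.mem_filter.1 hp).2]
      rw [Finset.prod_insert (by decide), Finset.prod_pair (by decide), hcon, hcon, hcon, hc1, hc2,
        hc3]
      ring
    have e2 := e fun v => ((if v = 1 then s ^ 2 + 4 * s else if v = -1 then s ^ 2 - 4 * s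
      else s ^ 2).factorial : ℝ)
    rw [show (∏ p, ((c p).factorial : ℝ)) = _ from e2]
    norm_num
    have h3 := factorial_shift_le s hs
    calc (((s ^ 2 + 4 * s).factorial : ℝ) * (s ^ 2 - 4 * s).factorial) ^ 2 *
          ((s ^ 2).factorial : ℝ) ^ 8
        ≤ (Real.exp 64 * ((s ^ 2).factorial : ℝ) ^ 2) ^ 2 * ((s ^ 2).factorial : ℝ) ^ 8 := by
          gcongr
      _ = Real.exp 128 * ((s ^ 2).factorial : ℝ) ^ 12 := by
          rw [mul_pow, ← Real.exp_nat_mul]; norm_num; ring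
  have hq := factorial_pow_le (s ^ 2) (Nat.one_le_pow _ _ (by omega))
  have hq' : ((s ^ 2).factorial : ℝ) ^ 12 * 12 ^ (12 * s ^ 2) ≤
      12 ^ 12 * (s : ℝ) ^ 24 * ((12 * s ^ 2).factorial : ℝ) := by
    have : (((s ^ 2).factorial ^ 12 * 12 ^ (12 * s ^ 2) : ℕ) : ℝ) ≤
      ((12 ^ 12 * (s ^ 2) ^ 12 * (12 * s ^ 2).factorial : ℕ) : ℝ) := by exact_mod_cast hq
    push_cast at this
    convert this using 2
    rw [← pow_mul]; norm_num
  have hF2' : ((12 * s ^ 2).factorial : ℝ) ≤ (∏ p, ((c p).factorial : ℝ)) * F.card := by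
    exact_mod_cast hF2
  have hfpos : (0 : ℝ) < ((s ^ 2).factorial : ℝ) ^ 12 := by positivity
  have hs0 : (0 : ℝ) < s := by positivity
  have hfin : ((s ^ 2).factorial : ℝ) ^ 12 * 12 ^ (12 * s ^ 2) ≤
      ((s ^ 2).factorial : ℝ) ^ 12 * (Real.exp 128 * 12 ^ 12 * (s : ℝ) ^ 24 * F.card) := by
    calc _ ≤ 12 ^ 12 * (s : ℝ) ^ 24 * ((12 * s ^ 2).factorial : ℝ) := hq'
      _ ≤ 12 ^ 12 * (s : ℝ) ^ 24 * ((Real.exp 128 * ((s ^ 2).factorial : ℝ) ^ 12) * F.card) := by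
        gcongr
        exact hF2'.trans (by gcongr)
      _ = _ := by ring
  have hfin2 := le_of_mul_le_mul_left hfin hfpos
  rw [inv_pow, ← div_eq_mul_inv, div_le_div_iff₀ (by positivity) (by positivity)]
  linarith

/-! ### Rounds -/

theorem foldl_step_congr {S : Strategy} {h h' : ℕ → BinPair} (ops : List Op)
    (hh : ∀ o ∈ ops, h o.ball = h' o.ball) (s : State) :
    ops.foldl (step S h) s = ops.foldl (step S h') s := by
  induction ops generalizing s with
  | nil => rfl
  | cons o ops ih =>
    have h1 : step S h s o = step S h' s o := by
      have := hh o (by simp)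
      cases o with
      | insert x => simp only [Op.ball] at this; simp only [step, this]
      | delete x => rfl
    rw [List.foldl_cons, List.foldl_cons, h1, ih fun o' ho' => hh o' (by simp [ho'])]

theorem reachesLoad_congr {S : Strategy} {h h' : ℕ → BinPair} {ops : List Op}
    (hh : ∀ o ∈ ops, h o.ball = h' o.ball) (L : ℝ) :
    ReachesLoad S h ops L ↔ ReachesLoad S h' ops L := by
  have : ∀ t, run S h (ops.take t) = run S h' (ops.take t) := fun t =>
    foldl_step_congr _ (fun o ho => hh o (List.mem_of_mem_take ho)) _
  unfold ReachesLoad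
  simp_rw [this]

theorem card_surplus_block (n s : ℕ) : (Finset.Ico n (n + 12 * s ^ 2)).card = 12 * s ^ 2 := by
  rw [Nat.card_Ico]; omega

variable {Ω : Type*} [MeasurableSpace Ω] {P : Measure Ω} [IsProbabilityMeasure P]

/-- The event that `ops` does not cause the load `L`. -/
def balanced (S : Ω → Strategy) (ops : List Op) (L : ℝ) : Set ((ℕ → BinPair) × Ω) :=
  {z | ¬ ReachesLoad (S z.2) z.1 ops L}

theorem measurableSet_balanced {S : Ω → Strategy}
    (hS : ∀ hist p, Measurable fun ω => S ω hist p) (ops : List Op) (L : ℝ) :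
    MeasurableSet (balanced S ops L) :=
  (measurableSet_reachesLoad (Z := (ℕ → BinPair) × Ω) (H := Prod.fst) (S := fun z => S z.2)
    (fun x => (measurable_pi_apply x).comp measurable_fst)
    (fun hist p => (hS hist p).comp measurable_snd) ops L).compl

/-- Whatever happened before, a further round, played with fresh balls, provokes an overload with
at least polynomially small probability. -/
theorem exists_round {S : Ω → Strategy} (hS : ∀ hist p, Measurable fun ω => S ω hist p)
    {m s : ℕ} {δ : ℝ} (hs : 8 ≤ s) (hm : 26 * s ^ 2 * (12 * s ^ 2) ≤ m) (hδ : 4 * δ + 1 ≤ s / 50)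
    (hδ0 : 0 ≤ δ) {pre : List Op} (hl : Legal m ∅ pre) (he : curr ∅ pre = ∅) :
    ∃ ext, ext.length ≤ 2 * m + 89928 * s ^ 6 ∧ Legal m ∅ (pre ++ ext) ∧
      curr ∅ (pre ++ ext) = ∅ ∧
      (hashMeasure.prod P).real (balanced S (pre ++ ext) (m / 4 + δ)) ≤
        (1 - 1 / (Real.exp 128 * 12 ^ 12 * (s : ℝ) ^ 24) * (1 / m)) *
          (hashMeasure.prod P).real (balanced S pre (m / 4 + δ)) := by
  classical
  set μ := hashMeasure.prod P with hμ
  set F := balanced S pre ((m : ℝ) / 4 + δ) with hF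
  have hFm : MeasurableSet F := measurableSet_balanced hS _ _
  -- a bound on all balls used so far
  obtain ⟨n, hn⟩ : ∃ n, ∀ o ∈ pre, o.ball < n := by
    refine ⟨(pre.map Op.ball).foldr max 0 + 1, fun o ho => Nat.lt_succ_of_le ?_⟩
    clear hl he hF hFm F
    induction pre with
    | nil => simp at ho
    | cons a pre ih =>
      simp only [List.map_cons, List.foldr_cons]
      rcases List.mem_cons.1 ho with rfl | h
      · exact le_max_left _ _
      · exact (ih h).trans (le_max_right _ _)
  set X := Finset.Ico n (n + 12 * s ^ 2) with hX
  have hXc : X.card = 12 * s ^ 2 := card_surplus_block n s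
  have hFd : ∀ ω, DeterminedBy (Finset.range n) {h | (h, ω) ∈ F} := by
    intro ω h h' hh
    exact not_congr (reachesLoad_congr (fun o ho => hh _ (Finset.mem_range.2 (hn o ho))) _)
  set T := surplus X s with hT
  have hTm : MeasurableSet T := (surplus_determinedBy X s).measurableSet
  set G := F ∩ Prod.fst ⁻¹' T with hG
  have hGm : MeasurableSet G := hFm.inter (measurable_fst hTm)
  have hGd : ∀ ω, DeterminedBy (Finset.range (n + 12 * s ^ 2)) {h | (h, ω) ∈ G} := by
    intro ω h h' hh
    refine and_congr (hFd ω h h' fun x hx => hh x ?_)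
      (surplus_determinedBy X s h h' fun x hx => hh x ?_)
    · rw [Finset.mem_range] at hx ⊢; omega
    · rw [hX, Finset.mem_Ico] at hx; rw [Finset.mem_range]; omega
  have hμG : μ G = μ F * hashMeasure T := by
    refine prod_inter P ?_ hFm hFd (surplus_determinedBy X s)
    rw [Finset.disjoint_left]
    intro x hx hx'
    rw [Finset.mem_range] at hx
    rw [hX, Finset.mem_Ico] at hx'
    omega
  have hμGr : μ.real G = μ.real F * hashMeasure.real T := by
    simp only [Measure.real, hμG, ENNReal.toReal_mul]
  by_cases hF0 : μ.real F = 0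
  · refine ⟨[], by simp, by simpa using hl, by simpa using he, ?_⟩
    rw [List.append_nil, ← hF, hF0, mul_zero]
  have hTpos : 0 < hashMeasure.real T := lt_of_lt_of_le (by positivity) (surplus_prob X hs hXc)
  have hG0 : μ G ≠ 0 := by
    intro h
    have : μ.real G = 0 := by simp [Measure.real, h]
    rw [hμGr] at this
    rcases mul_eq_zero.1 this with h | h
    · exact hF0 h
    · exact hTpos.ne' h
  -- from here on, condition on the earlier rounds having failed and on the bet being won
  set ν := μ[|G] with hν
  have : IsProbabilityMeasure ν := cond_isProbabilityMeasure hG0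
  have hfresh : ∀ n', n + 12 * s ^ 2 ≤ n' → ∀ p,
      ∫ z, |(cnt z.1 p (Finset.Ico n' (n' + 12 * s ^ 2)) : ℝ) - (s : ℝ) ^ 2| ∂ν ≤ s := by
    intro n' hn' p
    set Q := Finset.Ico n' (n' + 12 * s ^ 2) with hQ
    have hmc : Measurable fun z : (ℕ → BinPair) × Ω => cnt z.1 p Q :=
      (measurable_cnt p Q).comp measurable_fst
    have hmap : ν.map (fun z => cnt z.1 p Q) = hashMeasure.map (fun h => cnt h p Q) := by
      ext A hA
      rw [Measure.map_apply hmc hA, Measure.map_apply (measurable_cnt p Q) hA, hν,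
        cond_apply hGm]
      have hd : DeterminedBy Q ((fun h => cnt h p Q) ⁻¹' A) := fun h h' hh => by
        simp only [Set.mem_preimage]
        rw [cnt_congr hh]
      have h1 : μ (G ∩ (fun z : (ℕ → BinPair) × Ω => cnt z.1 p Q) ⁻¹' A) =
          μ G * hashMeasure ((fun h => cnt h p Q) ⁻¹' A) := by
        refine prod_inter P ?_ hGm hGd hd
        rw [Finset.disjoint_left]
        intro x hx hx'
        rw [Finset.mem_range] at hx
        rw [hQ, Finset.mem_Ico] at hx'
        omega
      rw [h1, ← mul_assoc, ENNReal.inv_mul_cancel hG0 (measure_ne_top _ _), one_mul]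
    have h2 := integral_map (μ := ν) hmc.aemeasurable
      (f := fun v : ℕ => |(v : ℝ) - (s : ℝ) ^ 2|) measurable_from_top.aestronglyMeasurable
    have h3 := integral_map (μ := hashMeasure) (measurable_cnt p Q).aemeasurable
      (f := fun v : ℕ => |(v : ℝ) - (s : ℝ) ^ 2|) measurable_from_top.aestronglyMeasurable
    rw [← h2, hmap, h3]
    exact integral_abs_cnt_le p Q (by omega) (card_surplus_block n' s)
  have hA : Arena ν (fun z : (ℕ → BinPair) × Ω => z.1) (fun z => S z.2) m s δ X
      (n + 12 * s ^ 2) :=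
    { measurable_hash := fun x => (measurable_pi_apply x).comp measurable_fst
      measurable_strategy := fun hist p => (hS hist p).comp measurable_snd
      s_pos := by omega
      le_m := hm
      delta_le := hδ
      delta_nonneg := hδ0
      card_X := hXc
      X_lt := fun x hx => (Finset.mem_Ico.1 hx).2
      cnt_X := by
        filter_upwards [ae_cond_mem hGm] with z hz
        exact hz.2
      cnt_fresh := hfresh }
  obtain ⟨ext, h1, h2, h3, h4⟩ := hA.exists_overload hl he
  refine ⟨ext, h1, h2, h3, ?_⟩
  set F' := balanced S (pre ++ ext) ((m : ℝ) / 4 + δ) with hF'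
  set Rch := {z : (ℕ → BinPair) × Ω |
    ReachesLoad (S z.2) z.1 (pre ++ ext) ((m : ℝ) / 4 + δ)} with hRch
  have hF'm : MeasurableSet F' := measurableSet_balanced hS _ _
  have hsub : F' ⊆ F := fun z hz hz' => hz (hz'.append ext)
  have hGR : G ∩ Rch ⊆ F \ F' := fun z hz => ⟨hz.1.1, fun h => h hz.2⟩
  have hνR : ν.real Rch = (μ.real G)⁻¹ * μ.real (G ∩ Rch) := by
    rw [Measure.real, hν, cond_apply hGm, ENNReal.toReal_mul, ENNReal.toReal_inv]
    rfl
  have hGpos : 0 < μ.real G := by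
    rw [hμGr]
    exact mul_pos (lt_of_le_of_ne measureReal_nonneg (Ne.symm hF0)) hTpos
  have h5 : 1 / m * μ.real G ≤ μ.real (F \ F') := by
    refine le_trans ?_ (measureReal_mono hGR)
    rw [hνR] at h4
    calc 1 / (m : ℝ) * μ.real G ≤ ((μ.real G)⁻¹ * μ.real (G ∩ Rch)) * μ.real G := by gcongr
      _ = μ.real (G ∩ Rch) := by field_simp
  rw [measureReal_sdiff hsub hF'm] at h5
  have h6 : 1 / (Real.exp 128 * 12 ^ 12 * (s : ℝ) ^ 24) * (1 / m) * μ.real F ≤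
      1 / m * μ.real G := by
    rw [hμGr]
    have := mul_le_mul_of_nonneg_right (surplus_prob X hs hXc)
      (by positivity : 0 ≤ 1 / (m : ℝ) * μ.real F)
    rw [← hT] at this
    linarith
  linarith

theorem exists_rounds {S : Ω → Strategy} (hS : ∀ hist p, Measurable fun ω => S ω hist p)
    {m s : ℕ} {δ : ℝ} (hs : 8 ≤ s) (hm : 26 * s ^ 2 * (12 * s ^ 2) ≤ m) (hδ : 4 * δ + 1 ≤ s / 50)
    (hδ0 : 0 ≤ δ) {r : ℝ} (hr0 : 0 ≤ r)
    (hr : 1 - 1 / (Real.exp 128 * 12 ^ 12 * (s : ℝ) ^ 24) * (1 / m) ≤ r) (R : ℕ) :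
    ∃ ops, ops.length ≤ R * (2 * m + 89928 * s ^ 6) ∧ Legal m ∅ ops ∧ curr ∅ ops = ∅ ∧
      (hashMeasure.prod P).real (balanced S ops (m / 4 + δ)) ≤ r ^ R := by
  induction R with
  | zero => exact ⟨[], by simp, by simp [Legal], by simp [curr], by simp [measureReal_le_one]⟩
  | succ R ih =>
    obtain ⟨pre, h1, h2, h3, h4⟩ := ih
    obtain ⟨ext, g1, g2, g3, g4⟩ := exists_round (P := P) hS hs hm hδ hδ0 h2 h3
    refine ⟨pre ++ ext, ?_, g2, g3, g4.trans ?_⟩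
    · rw [List.length_append, add_mul, one_mul]; omega
    · rw [pow_succ' r R]
      exact mul_le_mul hr h4 measureReal_nonneg hr0

/-- The parameters: `s` is about `m ^ (1 / 10)`, and `m ^ (1 / 20)` is much smaller. -/
theorem exists_parameter {m : ℕ} (K : ℕ) (hK : (10 ^ 6 + K) ^ 10 ≤ m) :
    ∃ s : ℕ, 10 ^ 6 + K ≤ s ∧ s ^ 10 ≤ m ∧ 4 * (m : ℝ) ^ (1 / 20 : ℝ) + 1 ≤ s / 50 := by
  have hex : ∃ s, m < (s + 1) ^ 10 :=
    ⟨m, lt_of_lt_of_le (Nat.lt_succ_self m) (Nat.le_self_pow (by norm_num) _)⟩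
  classical
  obtain ⟨s, hs, hmin⟩ : ∃ s, m < (s + 1) ^ 10 ∧ ∀ t < s, ¬ m < (t + 1) ^ 10 :=
    ⟨Nat.find hex, Nat.find_spec hex, fun t ht => Nat.find_min hex ht⟩
  have h1 : 10 ^ 6 + K ≤ s := by
    by_contra h
    have : (s + 1) ^ 10 ≤ (10 ^ 6 + K) ^ 10 := Nat.pow_le_pow_left (by omega) _
    omega
  have h2 : s ^ 10 ≤ m := by
    have := hmin (s - 1) (by omega)
    rw [Nat.sub_add_cancel (by omega)] at this
    omega
  refine ⟨s, h1, h2, ?_⟩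
  have hsr : (10 ^ 6 : ℝ) ≤ s := by
    have : 10 ^ 6 ≤ s := by omega
    exact_mod_cast this
  have h3 : (m : ℝ) ^ (1 / 20 : ℝ) ≤ Real.sqrt (s + 1) := by
    have h4 : (m : ℝ) ≤ ((s : ℝ) + 1) ^ (10 : ℕ) := by exact_mod_cast hs.le
    calc (m : ℝ) ^ (1 / 20 : ℝ) ≤ (((s : ℝ) + 1) ^ (10 : ℕ)) ^ (1 / 20 : ℝ) :=
          Real.rpow_le_rpow (Nat.cast_nonneg _) h4 (by norm_num)
      _ = Real.sqrt (s + 1) := by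
          rw [← Real.rpow_natCast, ← Real.rpow_mul (by positivity), Real.sqrt_eq_rpow]
          norm_num
  have h5 : Real.sqrt (s + 1) ≤ (s + 1) / 1000 := by
    rw [Real.sqrt_le_left (by positivity)]
    nlinarith
  linarith

end

end BallsBins

theorem mainTheorem3 :
    ∃ ε : ℝ, 0 < ε ∧ ∃ d : ℕ, ∀ c : ℝ, 0 < c → ∃ m₀ : ℕ, ∀ m : ℕ, m₀ ≤ m →
      ∀ (Ω : Type*) [MeasurableSpace Ω] (P : MeasureTheory.Measure Ω)
        [MeasureTheory.IsProbabilityMeasure P] (S : Ω → BallsBins.Strategy),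
        (∀ (hist : List BallsBins.Request) (p : BallsBins.BinPair),
          Measurable fun ω => S ω hist p) →
        ∃ ops : List BallsBins.Op,
          ops.length ≤ m ^ d ∧
          BallsBins.Legal m ∅ ops ∧
          1 - (m : ℝ) ^ (-c) ≤
            (BallsBins.hashMeasure.prod P).real
              {z : (ℕ → BallsBins.BinPair) × Ω |
                BallsBins.ReachesLoad (S z.2) z.1 ops ((m : ℝ) / 4 + (m : ℝ) ^ ε)} := by
  refine ⟨1 / 20, by norm_num, 7, fun c hc => ?_⟩
  obtain ⟨K, hK⟩ := exists_nat_ge (Real.exp 128 * 12 ^ 12)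
  have hlog : ∀ᶠ m : ℕ in Filter.atTop, c * Real.log m ≤ m := by
    have h1 := (Real.isLittleO_log_id_atTop.bound (inv_pos.2 hc)).and
      (Filter.eventually_ge_atTop (1 : ℝ))
    have h2 := tendsto_natCast_atTop_atTop (R := ℝ) |>.eventually h1
    filter_upwards [h2] with m hm
    have h3 := hm.1
    simp only [id, Real.norm_eq_abs] at h3
    rw [abs_of_nonneg (Real.log_nonneg hm.2), abs_of_nonneg (by linarith [hm.2])] at h3
    calc c * Real.log m ≤ c * (c⁻¹ * m) := mul_le_mul_of_nonneg_left h3 hc.le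
      _ = m := by field_simp
  obtain ⟨m₁, hm₁⟩ := Filter.eventually_atTop.1 hlog
  refine ⟨max m₁ ((10 ^ 6 + K) ^ 10), fun m hm Ω _ P _ S hS => ?_⟩
  obtain ⟨s, hsK, hsm, hδ⟩ := BallsBins.exists_parameter K ((le_max_right _ _).trans hm)
  have hs6 : 10 ^ 6 ≤ s := by omega
  have hm1 : 1 ≤ m := le_trans (Nat.one_le_pow _ _ (by omega)) hsm
  have hms : s ≤ m := le_trans (Nat.le_self_pow (by norm_num) _) hsm
  have hmr : (0 : ℝ) < m := by exact_mod_cast hm1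
  have hs0 : (0 : ℝ) < s := by exact_mod_cast (by omega : 0 < s)
  have hpow : s ^ 4 * s ^ 6 ≤ m := by rw [← pow_add]; exact hsm
  have hs4 : 89928 ≤ s ^ 4 := le_trans (by omega) (Nat.le_self_pow (by norm_num) s)
  have hlen : 89928 * s ^ 6 ≤ m := (Nat.mul_le_mul_right _ hs4).trans hpow
  have hcap : 26 * s ^ 2 * (12 * s ^ 2) ≤ m := by
    have e : 26 * s ^ 2 * (12 * s ^ 2) = 312 * s ^ 4 := by ring
    have h2 : s ^ 4 ≤ s ^ 6 := Nat.pow_le_pow_right (by omega) (by norm_num)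
    rw [e]; omega
  have hprob : 1 - 1 / (Real.exp 128 * 12 ^ 12 * (s : ℝ) ^ 24) * (1 / m) ≤
      1 - 1 / (m : ℝ) ^ 4 := by
    have h1 : Real.exp 128 * 12 ^ 12 * (s : ℝ) ^ 24 ≤ (m : ℝ) ^ 3 := by
      have h2 : Real.exp 128 * 12 ^ 12 ≤ (s : ℝ) := hK.trans (by exact_mod_cast (by omega : K ≤ s))
      have h3 : (s : ℝ) ^ 10 ≤ m := by exact_mod_cast hsm
      calc Real.exp 128 * 12 ^ 12 * (s : ℝ) ^ 24 ≤ (s : ℝ) * (s : ℝ) ^ 24 := by gcongr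
        _ = (s : ℝ) ^ 25 := by ring
        _ ≤ (s : ℝ) ^ 30 := pow_le_pow_right₀ (by exact_mod_cast (by omega : 1 ≤ s)) (by norm_num)
        _ = ((s : ℝ) ^ 10) ^ 3 := by ring
        _ ≤ (m : ℝ) ^ 3 := by gcongr
    have h4 : 1 / (m : ℝ) ^ 3 ≤ 1 / (Real.exp 128 * 12 ^ 12 * (s : ℝ) ^ 24) :=
      one_div_le_one_div_of_le (by positivity) h1
    have h5 : 1 / (m : ℝ) ^ 4 = 1 / (m : ℝ) ^ 3 * (1 / m) := by
      field_simp
    rw [h5]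
    have := mul_le_mul_of_nonneg_right h4 (by positivity : (0 : ℝ) ≤ 1 / m)
    linarith
  have hr0 : (0 : ℝ) ≤ 1 - 1 / (m : ℝ) ^ 4 := by
    rw [sub_nonneg, div_le_one (by positivity)]
    exact one_le_pow₀ (by exact_mod_cast hm1)
  obtain ⟨ops, h1, h2, _, h4⟩ := BallsBins.exists_rounds (P := P) hS (by omega) hcap hδ
    (by positivity) hr0 hprob (m ^ 5)
  refine ⟨ops, ?_, h2, ?_⟩
  · calc ops.length ≤ m ^ 5 * (2 * m + 89928 * s ^ 6) := h1
      _ ≤ m ^ 5 * (m * m) := by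
          refine Nat.mul_le_mul_left _ ?_
          nlinarith
      _ = m ^ 7 := by ring
  · have hfail : (1 - 1 / (m : ℝ) ^ 4) ^ m ^ 5 ≤ (m : ℝ) ^ (-c) := by
      calc (1 - 1 / (m : ℝ) ^ 4) ^ m ^ 5 ≤ Real.exp (-(1 / (m : ℝ) ^ 4)) ^ m ^ 5 :=
            pow_le_pow_left₀ hr0 (Real.one_sub_le_exp_neg _) _
        _ = Real.exp (-m) := by
            rw [← Real.exp_nat_mul]
            congr 1
            push_cast
            field_simp
        _ ≤ Real.exp (Real.log m * (-c)) := by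
            apply Real.exp_le_exp.2
            linarith [hm₁ m ((le_max_left _ _).trans hm)]
        _ = (m : ℝ) ^ (-c) := by rw [Real.rpow_def_of_pos hmr]
    have hcompl := probReal_compl_eq_one_sub (μ := BallsBins.hashMeasure.prod P)
      (BallsBins.measurableSet_balanced hS ops ((m : ℝ) / 4 + (m : ℝ) ^ (1 / 20 : ℝ)))
    have hset : (BallsBins.balanced S ops ((m : ℝ) / 4 + (m : ℝ) ^ (1 / 20 : ℝ)))ᶜ =
        {z : (ℕ → BallsBins.BinPair) × Ω |
          BallsBins.ReachesLoad (S z.2) z.1 ops ((m : ℝ) / 4 + (m : ℝ) ^ (1 / 20 : ℝ))} := by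
      ext z
      simp [BallsBins.balanced]
    rw [hset] at hcompl
    rw [hcompl]
    linarith
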